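/- Let $P_0(\xi)=\sum_{|\alpha|\le m}a_\alpha\xi^\alpha$ be a polynomial on $\mathbb{R}^n$ of degree $m\ge 2$ with real coefficients, and let $P_0=P_0(D)=\sum_{|\alpha|\le m} a_\alpha D^\alpha$, $D_j=-i\,\partial/\partial x_j$. Let $\Omega\subset\mathbb{R}^n$ be a bounded domain and let $V\in L^\infty(\mathbb{R}^n)$ be real-valued with $\operatorname{supp} V=\overline\Omega$ and $V\ge\delta>0$ a.e. in $\overline\Omega$ for some constant $\delta$. Let $H^{P_0}_0(\Omega)$ be the completion of $C_0^\infty(\Omega)$ with respect to the norm $\|P_0(D)\varphi\|_{L^2}$, regarded as a subspace of $L^2(\Omega)$ (it consists of the $L^2(\Omega)$-limits of sequences in $C_0^\infty(\Omega)$ that are Cauchy for this norm). A number $\lambda\in\mathbb{C}$ is called a transmission eigenvalue if there exist $0\ne v\in L^2_{\mathrm{loc}}(\Omega)$ and $0\ne w\in L^2_{\mathrm{loc}}(\Omega)$ such that $$(P_0-\lambda)v=0\ \text{ in }\Omega,\qquad (P_0-\lambda(1+V))w=0\ \text{ in }\Omega,\qquad v-w\in H^{P_0}_0(\Omega),$$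 the equations being understood in the sense of distributions. Put $$\widetilde P_0(\xi)=\Big(\sum_{\alpha}|\partial^\alpha P_0(\xi)|^2\Big)^{1/2},$$ the sum being over all multi-indices $\alpha\in\mathbb{N}^n$. Theorem. If $\widetilde P_0(\xi)\to\infty$ as $|\xi|\to\infty$, then the set of transmission eigenvalues is discrete, i.e. it is a closed discrete subset of $\mathbb{C}$ (it has no accumulation point in $\mathbb{C}$). -/

import Mathlib

open MeasureTheory TopologicalSpace Filter Topology
open scoped Distributions LineDeriv ENNReal

noncomputable section

namespace Acoustic

/-- Euclidean space `ℝⁿ`. -/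
abbrev Space (n : ℕ) : Type := EuclideanSpace ℝ (Fin n)

variable {n : ℕ} {Ω : Opens (Space n)}

/-- `D_j = -i ∂/∂x_j` on test functions on `Ω`. -/
def D (j : Fin n) (φ : 𝓓(Ω, ℂ)) : 𝓓(Ω, ℂ) :=
  (-Complex.I) • ∂_{EuclideanSpace.single j (1 : ℝ)} φ

/-- `D^α = D_1^{α_1} ⋯ D_n^{α_n}` on test functions. -/
def multiD (α : Fin n →₀ ℕ) (φ : 𝓓(Ω, ℂ)) : 𝓓(Ω, ℂ) :=
  (List.finRange n).foldr (fun j ψ => (D j)^[α j] ψ) φ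

/-- `P(D) φ = ∑_α a_α D^α φ`, where `P(ξ) = ∑_α a_α ξ^α` has real coefficients. -/
def diffOp (P : MvPolynomial (Fin n) ℝ) (φ : 𝓓(Ω, ℂ)) : 𝓓(Ω, ℂ) :=
  ∑ α ∈ P.support, ((P.coeff α : ℝ) : ℂ) • multiD α φ

/-- The formal transpose `P(-D) φ = ∑_α (-1)^{|α|} a_α D^α φ`, so that the distribution `P(D) u`
is `φ ↦ ⟨u, P(-D) φ⟩`. -/
def diffOpTranspose (P : MvPolynomial (Fin n) ℝ) (φ : 𝓓(Ω, ℂ)) : 𝓓(Ω, ℂ) :=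
  ∑ α ∈ P.support, ((-1 : ℂ) ^ α.degree * ((P.coeff α : ℝ) : ℂ)) • multiD α φ

/-- The partial derivative `∂^α P` of a polynomial. -/
def multiPderiv (α : Fin n → ℕ) (P : MvPolynomial (Fin n) ℝ) : MvPolynomial (Fin n) ℝ :=
  (List.finRange n).foldr (fun j Q => (MvPolynomial.pderiv j)^[α j] Q) P

/-- `P̃(ξ) = (∑_α |∂^α P(ξ)|²)^{1/2}`. The sum is over all multi-indices; it is written over those
with all `α_j ≤ deg P`, because `∂^α P = 0` for the others. -/
def symbolTilde (P : MvPolynomial (Fin n) ℝ) (ξ : Space n) : ℝ :=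
  Real.sqrt (∑ α : Fin n → Fin (P.totalDegree + 1),
    (MvPolynomial.eval (fun j => ξ j) (multiPderiv (fun j => (α j : ℕ)) P)) ^ 2)

/-- `u ∈ L²_loc(Ω)`. -/
def MemL2Loc (Ω : Opens (Space n)) (u : Space n → ℂ) : Prop :=
  ∀ K : Set (Space n), IsCompact K → K ⊆ Ω → MemLp u 2 (volume.restrict K)

/-- `u ∈ H^P_0(Ω)`: the completion of `C_0^∞(Ω)` for the norm `‖P(D)φ‖_{L²}`, realized as a space
of functions in `L²(Ω)`: the `L²(Ω)`-limits of sequences in `C_0^∞(Ω)` which are Cauchy for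
this norm. The realization is possible because `‖φ‖_{L²} ≤ C ‖P(D)φ‖_{L²}` on `C_0^∞(Ω)` for
bounded `Ω` and `P ≠ 0`, and because `P(D)` is closable in `L²(Ω)`. -/
def MemH0 (P : MvPolynomial (Fin n) ℝ) (Ω : Opens (Space n)) (u : Space n → ℂ) : Prop :=
  MemLp u 2 (volume.restrict (Ω : Set (Space n))) ∧
  ∃ φ : ℕ → 𝓓(Ω, ℂ),
    Tendsto (fun p : ℕ × ℕ => eLpNorm (diffOp P (φ p.1 - φ p.2)) 2 volume) atTop (𝓝 0) ∧
    Tendsto (fun k => eLpNorm (fun x => φ k x - u x) 2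
      (volume.restrict (Ω : Set (Space n)))) atTop (𝓝 0)

/-- `(P(D) - λ q) u = 0` in `𝒟'(Ω)`, for `u ∈ L²_loc(Ω)` and a bounded real function `q`. -/
def WeakSolution (P : MvPolynomial (Fin n) ℝ) (Ω : Opens (Space n)) (lam : ℂ)
    (q : Space n → ℝ) (u : Space n → ℂ) : Prop :=
  ∀ φ : 𝓓(Ω, ℂ),
    ∫ x in (Ω : Set (Space n)), u x * (diffOpTranspose P φ x - lam * (q x : ℂ) * φ x) = 0

/-- `λ` is a transmission eigenvalue: there are `v, w ∈ L²_loc(Ω)`, neither zero, with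
`(P(D) - λ) v = 0` and `(P(D) - λ (1 + V)) w = 0` in `Ω` and `v - w ∈ H^P_0(Ω)`. -/
def IsTransmissionEigenvalue (P : MvPolynomial (Fin n) ℝ) (Ω : Opens (Space n))
    (V : Space n → ℝ) (lam : ℂ) : Prop :=
  ∃ v w : Space n → ℂ,
    MemL2Loc Ω v ∧ MemL2Loc Ω w ∧
    ¬ (v =ᵐ[volume.restrict (Ω : Set (Space n))] 0) ∧
    ¬ (w =ᵐ[volume.restrict (Ω : Set (Space n))] 0) ∧
    WeakSolution P Ω lam (fun _ => 1) v ∧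
    WeakSolution P Ω lam (fun x => 1 + V x) w ∧
    MemH0 P Ω (v - w)

/-- The support of a (class of a) function `V`: the complement of the largest open set on which
`V = 0` almost everywhere. -/
def essSupport (V : Space n → ℝ) : Set (Space n) :=
  (volume.withDensity fun x => ‖V x‖ₑ).support

end Acoustic

end

/-! Put `u = v - w` and `f = P u`, the `L²` limit of `P φ_k`. Subtracting the two equations gives
`(P - λ) u = -λ V w` in `Ω`, so for `λ ≠ 0` the function `w` is recovered from `u`, and `u` solves
`(P - λ(1 + V)) V⁻¹ (P - λ) u = 0`. Splitting `V⁻¹` as `V^{-1/2} V^{-1/2}` turns this into `⟨pψ - λ̄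
N qψ, F - λU⟩ = 0` for all test functions `ψ`, where `p = V^{-1/2} P`, `q = V^{-1/2}`, `N` is
multiplication by `1 + V`, and `F`, `U` are the limits of `p φ_k`, `q φ_k`.

If `q = T p` with `T` completely continuous, then `U = T F`, and with `R` the projection onto the
closed range of `p` the problem becomes `F = λ (R T + T* N*) F - λ² T* N* T F`. Such a quadratic
pencil linearizes to an eigenvalue problem for one completely continuous operator on `E × E`, whose
eigenvalues `1/λ` can accumulate only at `0`. Hence each disc contains finitely many `λ`
(`finite_variational_pencil`).

The analytic input is the existence of `T`, that is, compactness of `H^P_0(Ω)` in `L²`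
(`tendsto_toL2_zero`). Since `Ω` is bounded, Fourier transforms of test functions obey a Bernstein
inequality, and a commutator argument gives Hörmander's bound of every `∂^α P` by `P`
(`exists_norm_pderiv_le`), hence `∫ P̃² |g|² ≤ K ‖P g‖²`. As `P̃ → ∞`, high frequencies are
uniformly small; low frequencies are handled by dominated convergence. -/

noncomputable section

namespace Acoustic

/-! ### Completely continuous operators and quadratic pencils -/

section CompletelyContinuous

variable {E F G : Type*} [NormedAddCommGroup E] [InnerProductSpace ℂ E]
  [NormedAddCommGroup F] [InnerProductSpace ℂ F] [NormedAddCommGroup G] [InnerProductSpace ℂ G]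

/-- A bounded sequence which tends weakly to zero. -/
def WeaklyNull (x : ℕ → E) : Prop :=
  (∃ C, ∀ k, ‖x k‖ ≤ C) ∧ ∀ y : E, Tendsto (fun k => inner ℂ y (x k)) atTop (𝓝 0)

/-- Operators which map weakly null sequences to norm null sequences. -/
def CompletelyContinuous (T : E →L[ℂ] F) : Prop :=
  ∀ x : ℕ → E, WeaklyNull x → Tendsto (fun k => T (x k)) atTop (𝓝 0)

theorem WeaklyNull.map [CompleteSpace E] [CompleteSpace F] {x : ℕ → E} (hx : WeaklyNull x)
    (T : E →L[ℂ] F) : WeaklyNull fun k => T (x k) := by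
  obtain ⟨⟨C, hC⟩, h⟩ := hx
  refine ⟨⟨‖T‖ * C, fun k => (T.le_opNorm _).trans (by gcongr; exact hC k)⟩, fun y => ?_⟩
  simpa [ContinuousLinearMap.adjoint_inner_left] using h (T.adjoint y)

theorem WeaklyNull.congr {x y : ℕ → E} (hx : WeaklyNull x)
    (h : Tendsto (fun k => y k - x k) atTop (𝓝 0)) : WeaklyNull y := by
  obtain ⟨⟨C, hC⟩, hw⟩ := hx
  obtain ⟨B, hB⟩ := h.norm.bddAbove_range
  refine ⟨⟨B + C, fun k => ?_⟩, fun z => ?_⟩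
  · calc ‖y k‖ = ‖(y k - x k) + x k‖ := by simp
      _ ≤ ‖y k - x k‖ + ‖x k‖ := norm_add_le _ _
      _ ≤ B + C := add_le_add (hB ⟨k, rfl⟩) (hC k)
  · have h1 : Tendsto (fun k => inner ℂ z (y k - x k)) atTop (𝓝 (inner ℂ z 0)) :=
      tendsto_const_nhds.inner h
    have := h1.add (hw z)
    simpa [inner_sub_right] using this

theorem CompletelyContinuous.comp_left {S : E →L[ℂ] F} (hS : CompletelyContinuous S)
    (T : F →L[ℂ] G) : CompletelyContinuous (T ∘L S) := fun x hx => by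
  simpa [Function.comp_def] using (T.continuous.tendsto 0).comp (hS x hx)

theorem CompletelyContinuous.comp_right [CompleteSpace E] [CompleteSpace F] {T : F →L[ℂ] G}
    (hT : CompletelyContinuous T) (S : E →L[ℂ] F) : CompletelyContinuous (T ∘L S) :=
  fun _ hx => hT _ (hx.map S)

theorem CompletelyContinuous.add {S T : E →L[ℂ] F} (hS : CompletelyContinuous S)
    (hT : CompletelyContinuous T) : CompletelyContinuous (S + T) := fun x hx => by
  simpa using (hS x hx).add (hT x hx)

/-- `‖T* x_k‖² = ⟨x_k, T T* x_k⟩ ≤ C ‖T (T* x_k)‖`, and `T* x_k` is again weakly null. -/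
theorem CompletelyContinuous.adjoint [CompleteSpace E] [CompleteSpace F] {T : E →L[ℂ] F}
    (hT : CompletelyContinuous T) : CompletelyContinuous (ContinuousLinearMap.adjoint T) := by
  intro x hx
  obtain ⟨C, hC⟩ := hx.1
  have h := hT _ (hx.map (ContinuousLinearMap.adjoint T))
  have h2 : Tendsto (fun k => ‖ContinuousLinearMap.adjoint T (x k)‖ ^ 2) atTop (𝓝 0) := by
    refine squeeze_zero (fun k => by positivity) (fun k => ?_)
      (by simpa using h.norm.const_mul C)
    have : ‖ContinuousLinearMap.adjoint T (x k)‖ ^ 2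
        = ‖inner ℂ (x k) (T (ContinuousLinearMap.adjoint T (x k)))‖ := by
      rw [← ContinuousLinearMap.adjoint_inner_left, inner_self_eq_norm_sq_to_K]
      simp
    rw [this]
    exact (norm_inner_le_norm _ _).trans (by gcongr; exact hC k)
  rw [tendsto_zero_iff_norm_tendsto_zero]
  simpa using h2.sqrt

theorem Orthonormal.weaklyNull [CompleteSpace E] {e : ℕ → E} (he : Orthonormal ℂ e) :
    WeaklyNull e := by
  refine ⟨⟨1, fun k => (he.1 k).le⟩, fun y => ?_⟩
  have h := (he.inner_products_summable y).tendsto_atTop_zero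
  rw [tendsto_zero_iff_norm_tendsto_zero]
  have := h.sqrt
  simpa [norm_inner_symm] using this

open Module End Submodule InnerProductSpace in
/-- Away from zero a completely continuous operator has only finitely many eigenvalues. -/
theorem CompletelyContinuous.finite_eigenvalues [CompleteSpace E] {T : E →L[ℂ] E}
    (hT : CompletelyContinuous T) {r : ℝ} (hr : 0 < r) :
    {μ : ℂ | r ≤ ‖μ‖ ∧ HasEigenvalue (T : End ℂ E) μ}.Finite := by
  by_contra hinf
  have hinf : {μ : ℂ | r ≤ ‖μ‖ ∧ HasEigenvalue (T : End ℂ E) μ}.Infinite := hinf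
  let μ : ℕ → ℂ := fun k => (hinf.natEmbedding _ k : ℂ)
  have hμinj : Function.Injective μ :=
    Subtype.val_injective.comp (hinf.natEmbedding _).injective
  have hμ : ∀ k, r ≤ ‖μ k‖ ∧ HasEigenvalue (T : End ℂ E) (μ k) :=
    fun k => (hinf.natEmbedding _ k).2
  choose z hz using fun k => (hμ k).2.exists_hasEigenvector
  have hlin : LinearIndependent ℂ z := eigenvectors_linearIndependent' _ μ hμinj z hz
  have hTz : ∀ k, T (z k) = μ k • z k := fun k => (hz k).apply_eq_smul
  have he := gramSchmidtNormed_orthonormal hlin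
  set e := gramSchmidtNormed ℂ z with he_def
  -- After Gram–Schmidt `T` is triangular with diagonal `μ k`: `T - μ k` sends the span of the first
  -- eigenvectors up to index `k` into the span of those below `k`, which is orthogonal to `e k`.
  have hinner : ∀ k, inner ℂ (e k) (T (e k)) = μ k := by
    intro k
    have hspan : ∀ c, span ℂ (e '' Set.Iio c) = span ℂ (z '' Set.Iio c) := by
      intro c
      rw [he_def, span_gramSchmidtNormed, span_gramSchmidt_Iio]
    have hmem : e k ∈ span ℂ (z '' Set.Iic k) := by
      rw [← span_gramSchmidt_Iic, ← span_gramSchmidtNormed]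
      exact subset_span ⟨k, le_refl k, rfl⟩
    have hdiff : T (e k) - μ k • e k ∈ span ℂ (z '' Set.Iio k) := by
      have key : ∀ y ∈ span ℂ (z '' Set.Iic k), T y - μ k • y ∈ span ℂ (z '' Set.Iio k) := by
        intro y hy
        induction hy using span_induction with
        | mem y hy =>
          obtain ⟨i, hi, rfl⟩ := hy
          rw [hTz, ← sub_smul]
          rcases eq_or_lt_of_le (show i ≤ k from hi) with rfl | hlt
          · simp
          · exact smul_mem _ _ (subset_span ⟨i, hlt, rfl⟩)
        | zero => simp
        | add y w _ _ h1 h2 =>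
          have := add_mem h1 h2
          convert this using 1
          rw [map_add, smul_add]; abel
        | smul c y _ h1 =>
          have := smul_mem _ c h1
          convert this using 1
          rw [map_smul, smul_sub, smul_comm]
      exact key _ hmem
    rw [← hspan] at hdiff
    have horth : inner ℂ (e k) (T (e k) - μ k • e k) = 0 := by
      generalize T (e k) - μ k • e k = w at hdiff
      induction hdiff using span_induction with
      | mem y hy =>
        obtain ⟨i, hi, rfl⟩ := hy
        exact he.2 (ne_of_gt hi)
      | zero => simp
      | add y w _ _ h1 h2 => rw [inner_add_right, h1, h2, add_zero]
      | smul c y _ h1 => rw [inner_smul_right, h1, mul_zero]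
    rw [inner_sub_right, inner_smul_right, inner_self_eq_norm_sq_to_K, he.1 k, sub_eq_zero] at horth
    simpa using horth
  -- An orthonormal sequence is weakly null, so `T (e k) → 0`, whereas `‖T (e k)‖ ≥ ‖μ k‖ ≥ r`.
  have h0 := (hT e (Orthonormal.weaklyNull he)).norm
  rw [norm_zero] at h0
  obtain ⟨k, hk⟩ := (h0.eventually (gt_mem_nhds hr)).exists
  have : ‖μ k‖ ≤ ‖T (e k)‖ := by
    rw [← hinner k]
    exact (norm_inner_le_norm _ _).trans (by rw [he.1 k, one_mul])
  linarith [(hμ k).1]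

/-- A quadratic operator pencil with completely continuous coefficients has only finitely many
characteristic values in each disc. -/
theorem CompletelyContinuous.finite_pencil [CompleteSpace E] {K L S : E →L[ℂ] E}
    (hK : CompletelyContinuous K) (hL : CompletelyContinuous L) (hS : CompletelyContinuous S)
    (r : ℝ) :
    {lam : ℂ | ‖lam‖ ≤ r ∧ ∃ f : E, f ≠ 0 ∧ f = lam • K f + lam ^ 2 • L (S f)}.Finite := by
  let H := WithLp 2 (E × E)
  let p₁ : H →L[ℂ] E := WithLp.fstL 2 ℂ E E
  let p₂ : H →L[ℂ] E := WithLp.sndL 2 ℂ E E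
  let i := (WithLp.prodContinuousLinearEquiv 2 ℂ E E).symm.toContinuousLinearMap
  -- The linearization `(f, g) ↦ (K f + L g, S f)`: a solution `f` of the pencil gives the
  -- eigenvector `(f, λ S f)` with eigenvalue `λ⁻¹`.
  let T : H →L[ℂ] H := i ∘L ((K ∘L p₁ + L ∘L p₂).prod (S ∘L p₁))
  have hT : CompletelyContinuous T := by
    intro x hx
    have h1 := (hK.comp_right p₁).add (hL.comp_right p₂) x hx
    have h2 := (hS.comp_right p₁) x hx
    have h3 := h1.prodMk_nhds h2
    rw [← map_zero i]
    exact (i.continuous.tendsto (0, 0)).comp h3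
  -- The bound `|r| + 1` in place of `r` keeps the threshold positive for every real `r`.
  have hfin := hT.finite_eigenvalues (r := (|r| + 1)⁻¹) (by positivity)
  refine (hfin.image fun μ => μ⁻¹).subset ?_
  rintro lam ⟨hr, f, hf, h⟩
  have hlam : lam ≠ 0 := by
    rintro rfl
    simp at h
    exact hf h
  refine ⟨lam⁻¹, ⟨?_, ?_⟩, inv_inv lam⟩
  · rw [norm_inv]
    have := norm_pos_iff.2 hlam
    gcongr
    linarith [le_abs_self r]
  · refine Module.End.hasEigenvalue_of_hasEigenvector
      (x := (WithLp.toLp 2 (f, lam • S f) : H)) ?_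
    rw [Module.End.hasEigenvector_iff, Module.End.mem_eigenspace_iff]
    constructor
    · rw [eq_inv_smul_iff₀ hlam]
      apply (WithLp.equiv 2 _).injective
      refine Prod.ext ?_ ?_
      · change lam • (K f + L (lam • S f)) = f
        rw [map_smul, smul_add, smul_smul, ← pow_two]
        exact h.symm
      · rfl
    · intro h0
      exact hf (congrArg (fun x : H => x.fst) h0)

end CompletelyContinuous

/-! ### From a variational problem to a pencil -/

section Pencil

variable {E X : Type*} [NormedAddCommGroup E] [InnerProductSpace ℂ E] [CompleteSpace E]
  [AddCommGroup X] [Module ℂ X]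

/-- If `q` is bounded and compact relative to `p`, then `q = T p` for a completely continuous
operator `T`. -/
theorem exists_completelyContinuous_extension (p q : X →ₗ[ℂ] E)
    (hbound : ∃ C, ∀ φ, ‖q φ‖ ≤ C * ‖p φ‖)
    (hcompact : ∀ φ : ℕ → X, (∃ M, ∀ k, ‖p (φ k)‖ ≤ M) → WeaklyNull (fun k => q (φ k)) →
      Tendsto (fun k => q (φ k)) atTop (𝓝 0)) :
    ∃ T : E →L[ℂ] E, CompletelyContinuous T ∧ (∀ φ, T (p φ) = q φ) ∧
      T ∘L (LinearMap.range p).topologicalClosure.starProjection = T := by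
  set R := (LinearMap.range p).topologicalClosure with hR
  have hRmem : ∀ φ, p φ ∈ R := fun φ =>
    Submodule.le_topologicalClosure _ (LinearMap.mem_range_self p φ)
  have hRc : IsClosed (R : Set E) := Submodule.isClosed_topologicalClosure _
  have : CompleteSpace R := hRc.completeSpace_coe
  let p' : X →ₗ[ℂ] R := p.codRestrict R hRmem
  have hdense : DenseRange p' := by
    intro x
    rw [Metric.mem_closure_iff]
    intro ε hε
    have hx : (x : E) ∈ closure (LinearMap.range p : Set E) := by
      rw [← Submodule.topologicalClosure_coe]
      exact x.2
    obtain ⟨_, ⟨φ, rfl⟩, hφ⟩ := Metric.mem_closure_iff.1 hx ε hε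
    exact ⟨p' φ, ⟨φ, rfl⟩, hφ⟩
  -- `p φ ↦ q φ` is well defined and bounded by `hbound`; it is extended to the closure `R` of the
  -- range of `p` by density and by zero on the orthogonal complement.
  let T : E →L[ℂ] E := (q.extendOfNorm p') ∘L R.orthogonalProjectionOnto
  have hTp : ∀ φ, T (p φ) = q φ := by
    intro φ
    have h1 : R.orthogonalProjectionOnto (p φ) = p' φ :=
      Submodule.orthogonalProjectionOnto_mem_subspace_eq_self (K := R) (p' φ)
    change q.extendOfNorm p' (R.orthogonalProjectionOnto (p φ)) = q φ
    rw [h1]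
    exact LinearMap.extendOfNorm_eq hdense hbound φ
  have hTR : T ∘L R.starProjection = T := by
    ext x
    change q.extendOfNorm p' (R.orthogonalProjectionOnto (R.orthogonalProjectionOnto x : E)) = _
    rw [Submodule.orthogonalProjectionOnto_mem_subspace_eq_self]
    rfl
  refine ⟨T, fun x hx => ?_, hTp, hTR⟩
  -- `hcompact` speaks only of elements of `X`, so the projection of `x k` to `R` is replaced by
  -- some `p (φ k)` with an error tending to zero.
  have happrox : ∀ k : ℕ, ∃ φ, ‖p φ - R.starProjection (x k)‖ < 1 / ((k : ℝ) + 1) := by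
    intro k
    have hmem : R.starProjection (x k) ∈ closure (LinearMap.range p : Set E) := by
      rw [← Submodule.topologicalClosure_coe]
      exact Submodule.starProjection_apply_mem _ _
    obtain ⟨_, ⟨φ, rfl⟩, hφ⟩ := Metric.mem_closure_iff.1 hmem (1 / ((k : ℝ) + 1)) (by positivity)
    exact ⟨φ, by rwa [← dist_eq_norm, dist_comm]⟩
  choose φ hφ using happrox
  have hzero : Tendsto (fun k => p (φ k) - R.starProjection (x k)) atTop (𝓝 0) :=
    squeeze_zero_norm (fun k => (hφ k).le) tendsto_one_div_add_atTop_nhds_zero_nat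
  have hpw : WeaklyNull fun k => p (φ k) := (hx.map R.starProjection).congr hzero
  have hqw : WeaklyNull fun k => q (φ k) := by
    have := hpw.map T
    simpa only [hTp] using this
  have hq0 := hcompact φ hpw.1 hqw
  have hd := (T.continuous.tendsto 0).comp hzero
  have hsub := hq0.sub hd
  simp only [map_zero, sub_zero] at hsub
  refine hsub.congr fun k => ?_
  have h2 := DFunLike.congr_fun hTR (x k)
  simp only [ContinuousLinearMap.comp_apply] at h2
  simp [hTp, h2]

/-- Discreteness for the variational problem `⟨p ψ - λ̄ N q ψ, F - λ U⟩ = 0` for all `ψ`, where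
`(F, U)` is in the closure of the pairs `(p φ, q φ)`. -/
theorem finite_variational_pencil (p q : X →ₗ[ℂ] E) (N : E →L[ℂ] E)
    (hbound : ∃ C, ∀ φ, ‖q φ‖ ≤ C * ‖p φ‖)
    (hcompact : ∀ φ : ℕ → X, (∃ M, ∀ k, ‖p (φ k)‖ ≤ M) → WeaklyNull (fun k => q (φ k)) →
      Tendsto (fun k => q (φ k)) atTop (𝓝 0)) (r : ℝ) :
    {lam : ℂ | ‖lam‖ ≤ r ∧ ∃ (φ : ℕ → X) (F U : E), F ≠ 0 ∧
      Tendsto (fun k => p (φ k)) atTop (𝓝 F) ∧ Tendsto (fun k => q (φ k)) atTop (𝓝 U) ∧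
      ∀ ψ, inner ℂ (p ψ - (starRingEnd ℂ) lam • N (q ψ)) (F - lam • U) = 0}.Finite := by
  obtain ⟨T, hT, hTp, hTR⟩ := exists_completelyContinuous_extension p q hbound hcompact
  set R := (LinearMap.range p).topologicalClosure with hR
  have hRmem : ∀ φ, p φ ∈ R := fun φ =>
    Submodule.le_topologicalClosure _ (LinearMap.mem_range_self p φ)
  have hRc : IsClosed (R : Set E) := Submodule.isClosed_topologicalClosure _
  let L : E →L[ℂ] E := ContinuousLinearMap.adjoint T ∘L ContinuousLinearMap.adjoint N
  have hL : CompletelyContinuous L := hT.adjoint.comp_right _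
  have hnegL : CompletelyContinuous (-L) := fun x hx => by simpa using (hL x hx).neg
  refine (((hT.comp_left R.starProjection).add hL).finite_pencil hnegL hT r).subset ?_
  rintro lam ⟨hr, φ, F, U, hF, hpF, hqU, heq⟩
  refine ⟨hr, F, hF, ?_⟩
  have hU : U = T F := by
    refine tendsto_nhds_unique hqU ?_
    have := (T.continuous.tendsto F).comp hpF
    simpa only [Function.comp_def, hTp] using this
  have hFR : F ∈ R := hRc.mem_of_tendsto hpF (Eventually.of_forall fun k => hRmem _)
  subst hU
  have hall : ∀ g ∈ R,
      inner ℂ (g - (starRingEnd ℂ) lam • N (T g)) (F - lam • T F) = 0 := by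
    intro g hg
    have hcl : IsClosed {g : E | inner ℂ (g - (starRingEnd ℂ) lam • N (T g)) (F - lam • T F) = 0} :=
      isClosed_eq (by fun_prop) continuous_const
    refine hcl.closure_subset_iff.2 ?_ (show g ∈ closure (LinearMap.range p : Set E) from hg)
    rintro _ ⟨ψ, rfl⟩
    simpa [hTp] using heq ψ
  rw [← sub_eq_zero]
  refine ext_inner_left ℂ fun g => ?_
  -- The equation is known only for `g ∈ R`. For arbitrary `g` it is tested with the projection of
  -- `g`; since `T` and `F` ignore the complement of `R`, a projection survives only in the term
  -- `⟨g, T F⟩`.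
  have h1 := hall (R.starProjection g) (Submodule.starProjection_apply_mem _ _)
  have h2 := DFunLike.congr_fun hTR g
  simp only [ContinuousLinearMap.comp_apply] at h2
  have h3 : inner ℂ (R.starProjection g) F = inner ℂ g F := by
    rw [Submodule.inner_starProjection_left_eq_right,
      Submodule.starProjection_eq_self_iff.2 hFR]
  rw [h2] at h1
  simp only [inner_sub_left, inner_sub_right, inner_smul_left, inner_smul_right, h3,
    RingHomCompTriple.comp_apply, RingHom.id_apply,
    Submodule.inner_starProjection_left_eq_right] at h1
  simp only [L, inner_sub_right, inner_add_right, inner_smul_right, add_apply,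
    neg_apply, ContinuousLinearMap.comp_apply, inner_neg_right,
    ContinuousLinearMap.adjoint_inner_right, inner_zero_right]
  linear_combination h1

end Pencil

/-! ### Differential operators as Fourier multipliers -/

open scoped SchwartzMap FourierTransform ContDiff
open MvPolynomial (X C monomial pderiv eval)

variable {n : ℕ} {Ω : Opens (Space n)}

/-- A test function on `Ω`, extended by zero, as a Schwartz function. -/
def toSchwartz : 𝓓(Ω, ℂ) →ₗ[ℂ] 𝓢(Space n, ℂ) where
  toFun φ := φ.hasCompactSupport.toSchwartzMap φ.contDiff
  map_add' _ _ := rfl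
  map_smul' _ _ := rfl

@[simp] theorem toSchwartz_apply (φ : 𝓓(Ω, ℂ)) (x : Space n) : toSchwartz φ x = φ x := rfl

theorem toSchwartz_injective : Function.Injective (toSchwartz (Ω := Ω)) := fun φ ψ h => by
  ext x
  exact DFunLike.congr_fun h x

/-- The symbol `P(2πξ)` of `P(D)`, for the Fourier transform with kernel `e^{-2πi x·ξ}`. -/
def symb (P : MvPolynomial (Fin n) ℝ) (ξ : Space n) : ℝ := eval (fun j => 2 * Real.pi * ξ j) P

theorem hasTemperateGrowth_symb (P : MvPolynomial (Fin n) ℝ) : (symb P).HasTemperateGrowth := by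
  unfold symb
  induction P using MvPolynomial.induction_on with
  | C a => simp
  | add p q hp hq => simpa using! hp.add hq
  | mul_X p j hp =>
    have : (fun ξ : Space n => ξ j).HasTemperateGrowth :=
      (EuclideanSpace.proj (𝕜 := ℝ) j).hasTemperateGrowth
    simpa using! hp.mul ((Function.HasTemperateGrowth.const (2 * Real.pi)).mul this)

/-- Multiplication by the symbol of `P(D)`. -/
def mulSymb (P : MvPolynomial (Fin n) ℝ) : 𝓢(Space n, ℂ) →L[ℂ] 𝓢(Space n, ℂ) :=
  SchwartzMap.smulLeftCLM ℂ (fun ξ => (symb P ξ : ℂ))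

@[simp] theorem mulSymb_apply (P : MvPolynomial (Fin n) ℝ) (g : 𝓢(Space n, ℂ)) (ξ : Space n) :
    mulSymb P g ξ = symb P ξ * g ξ := by
  have : (fun ξ => (symb P ξ : ℂ)).HasTemperateGrowth :=
    Complex.ofRealCLM.hasTemperateGrowth.comp (hasTemperateGrowth_symb P)
  rw [mulSymb, SchwartzMap.smulLeftCLM_apply_apply this, smul_eq_mul]

theorem fourier_D (j : Fin n) (φ : 𝓓(Ω, ℂ)) (ξ : Space n) :
    𝓕 (toSchwartz (D j φ)) ξ = (2 * Real.pi * ξ j : ℝ) * 𝓕 (toSchwartz φ) ξ := by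
  have h : toSchwartz (D j φ)
      = (-Complex.I) • ∂_{EuclideanSpace.single j (1 : ℝ)} (toSchwartz φ) := rfl
  have h' : (inner ℝ · (EuclideanSpace.single j (1 : ℝ)) : Space n → ℝ).HasTemperateGrowth := by
    fun_prop
  rw [h, FourierTransform.fourier_smul, SchwartzMap.fourier_lineDerivOp_eq, smul_apply,
    smul_apply, SchwartzMap.smulLeftCLM_apply_apply h', EuclideanSpace.inner_single_right]
  simp only [smul_eq_mul, Complex.real_smul, conj_trivial]
  push_cast
  linear_combination -(2 * Real.pi * ξ j * 𝓕 (toSchwartz φ) ξ) * Complex.I_sq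

theorem fourier_D_iterate (j : Fin n) (k : ℕ) (φ : 𝓓(Ω, ℂ)) (ξ : Space n) :
    𝓕 (toSchwartz ((D j)^[k] φ)) ξ = ((2 * Real.pi * ξ j) ^ k : ℝ) * 𝓕 (toSchwartz φ) ξ := by
  induction k with
  | zero => simp
  | succ k ih =>
    rw [Function.iterate_succ_apply', fourier_D, ih]
    push_cast
    ring

theorem fourier_multiD (α : Fin n →₀ ℕ) (φ : 𝓓(Ω, ℂ)) (ξ : Space n) :
    𝓕 (toSchwartz (multiD α φ)) ξ
      = (∏ j, (2 * Real.pi * ξ j) ^ α j : ℝ) * 𝓕 (toSchwartz φ) ξ := by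
  have h : ∀ l : List (Fin n), 𝓕 (toSchwartz (l.foldr (fun j ψ => (D j)^[α j] ψ) φ)) ξ
      = ((l.map fun j => (2 * Real.pi * ξ j) ^ α j).prod : ℝ) * 𝓕 (toSchwartz φ) ξ := by
    intro l
    induction l with
    | nil => simp
    | cons j l ih =>
      rw [List.foldr_cons, fourier_D_iterate, ih]
      simp only [List.map_cons, List.prod_cons]
      push_cast
      ring
  rw [multiD, h, ← List.ofFn_eq_map, List.prod_ofFn]

theorem fourier_diffOp (P : MvPolynomial (Fin n) ℝ) (φ : 𝓓(Ω, ℂ)) :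
    𝓕 (toSchwartz (diffOp P φ)) = mulSymb P (𝓕 (toSchwartz φ)) := by
  ext ξ
  rw [mulSymb_apply, symb, MvPolynomial.eval_eq', diffOp, map_sum,
    ← FourierTransform.fourierCLM_apply (R := ℂ), map_sum, sum_apply]
  push_cast
  rw [Finset.sum_mul]
  refine Finset.sum_congr rfl fun α _ => ?_
  rw [map_smul, map_smul, smul_apply, FourierTransform.fourierCLM_apply, fourier_multiD]
  push_cast
  rw [smul_eq_mul, mul_assoc]

/-- `P(D)` as a linear map on test functions. -/
def diffOpLin (P : MvPolynomial (Fin n) ℝ) : 𝓓(Ω, ℂ) →ₗ[ℂ] 𝓓(Ω, ℂ) where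
  toFun := diffOp P
  map_add' φ ψ := by
    apply toSchwartz_injective
    apply (FourierTransform.fourierCLE ℂ 𝓢(Space n, ℂ)).injective
    simp [fourier_diffOp]
  map_smul' c φ := by
    apply toSchwartz_injective
    apply (FourierTransform.fourierCLE ℂ 𝓢(Space n, ℂ)).injective
    simp [fourier_diffOp, FourierTransform.fourier_smul]

@[simp] theorem diffOpLin_apply (P : MvPolynomial (Fin n) ℝ) (φ : 𝓓(Ω, ℂ)) :
    diffOpLin P φ = diffOp P φ := rfl

/-- The class in `L²(ℝⁿ)` of a test function. -/
def toL2 : 𝓓(Ω, ℂ) →ₗ[ℂ] Lp ℂ 2 (volume : Measure (Space n)) :=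
  (SchwartzMap.toLpCLM ℂ ℂ 2 volume).toLinearMap ∘ₗ toSchwartz

theorem toL2_apply (φ : 𝓓(Ω, ℂ)) : toL2 φ = (toSchwartz φ).toLp 2 := rfl

theorem coeFn_toL2 (φ : 𝓓(Ω, ℂ)) : toL2 φ =ᵐ[volume] φ := (toSchwartz φ).coeFn_toLp 2 volume

theorem inner_mulSymb (P : MvPolynomial (Fin n) ℝ) (g h : 𝓢(Space n, ℂ)) :
    inner ℂ ((mulSymb P g).toLp 2) (h.toLp 2) = inner ℂ (g.toLp 2) ((mulSymb P h).toLp 2) := by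
  simp only [SchwartzMap.inner_toL2_toL2_eq]
  congr 1
  ext ξ
  simp
  ring

theorem norm_toL2_diffOp (P : MvPolynomial (Fin n) ℝ) (φ : 𝓓(Ω, ℂ)) :
    ‖toL2 (diffOp P φ)‖ = ‖(mulSymb P (𝓕 (toSchwartz φ))).toLp 2‖ := by
  rw [toL2_apply, ← SchwartzMap.norm_fourier_toL2_eq, fourier_diffOp]

theorem norm_toL2 (φ : 𝓓(Ω, ℂ)) :
    ‖toL2 φ‖ = ‖(𝓕 (toSchwartz φ)).toLp 2‖ := by
  rw [toL2_apply, ← SchwartzMap.norm_fourier_toL2_eq]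

/-- By Plancherel `P(D)` is multiplication by a symbol, which is real because the coefficients of
`P` are; so `P(D)` is symmetric. -/
theorem inner_diffOp (P : MvPolynomial (Fin n) ℝ) (φ ψ : 𝓓(Ω, ℂ)) :
    inner ℂ (toL2 (diffOp P φ)) (toL2 ψ) = inner ℂ (toL2 φ) (toL2 (diffOp P ψ)) := by
  simp only [toL2_apply]
  rw [← SchwartzMap.inner_fourier_toL2_eq, fourier_diffOp, inner_mulSymb, ← fourier_diffOp,
    SchwartzMap.inner_fourier_toL2_eq]

/-! ### Conjugation and the transpose -/

/-- The complex conjugate of a test function. -/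
def conjTest (φ : 𝓓(Ω, ℂ)) : 𝓓(Ω, ℂ) :=
  TestFunction.postcompCLM (𝕜 := ℝ) (Complex.conjCLE : ℂ →L[ℝ] ℂ) φ

@[simp] theorem conjTest_apply (φ : 𝓓(Ω, ℂ)) (x : Space n) :
    conjTest φ x = (starRingEnd ℂ) (φ x) := rfl

@[simp] theorem conjTest_conjTest (φ : 𝓓(Ω, ℂ)) : conjTest (conjTest φ) = φ := by
  ext x
  simp

theorem D_apply (j : Fin n) (φ : 𝓓(Ω, ℂ)) (x : Space n) :
    D j φ x = -Complex.I * fderiv ℝ φ x (EuclideanSpace.single j 1) := by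
  have : D j φ x = toSchwartz (D j φ) x := rfl
  rw [this]
  rfl

theorem D_smul (j : Fin n) (c : ℂ) (φ : 𝓓(Ω, ℂ)) : D j (c • φ) = c • D j φ := by
  rw [D, D, LineDeriv.lineDerivOp_smul, smul_comm]

theorem D_iterate_smul (j : Fin n) (k : ℕ) (c : ℂ) (φ : 𝓓(Ω, ℂ)) :
    (D j)^[k] (c • φ) = c • (D j)^[k] φ := by
  induction k with
  | zero => rfl
  | succ k ih => rw [Function.iterate_succ_apply', ih, D_smul, Function.iterate_succ_apply']

theorem conjTest_D (j : Fin n) (φ : 𝓓(Ω, ℂ)) :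
    conjTest (D j φ) = (-1 : ℂ) • D j (conjTest φ) := by
  ext x
  have hd : HasFDerivAt φ (fderiv ℝ φ x) x :=
    ((φ.contDiff.differentiable (by simp)) x).hasFDerivAt
  have h : HasFDerivAt (conjTest φ) ((Complex.conjCLE : ℂ →L[ℝ] ℂ).comp (fderiv ℝ φ x)) x :=
    (Complex.conjCLE : ℂ →L[ℝ] ℂ).hasFDerivAt.comp x hd
  rw [smul_apply, conjTest_apply, D_apply, D_apply, h.fderiv]
  simp

theorem conjTest_D_iterate (j : Fin n) (k : ℕ) (φ : 𝓓(Ω, ℂ)) :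
    conjTest ((D j)^[k] φ) = ((-1 : ℂ) ^ k) • (D j)^[k] (conjTest φ) := by
  induction k with
  | zero => simp
  | succ k ih =>
    rw [Function.iterate_succ_apply', conjTest_D, ih, D_smul, smul_smul, Function.iterate_succ_apply',
      pow_succ']

theorem conjTest_multiD (α : Fin n →₀ ℕ) (φ : 𝓓(Ω, ℂ)) :
    conjTest (multiD α φ) = ((-1 : ℂ) ^ α.degree) • multiD α (conjTest φ) := by
  have h : ∀ l : List (Fin n), conjTest (l.foldr (fun j ψ => (D j)^[α j] ψ) φ)
      = ((-1 : ℂ) ^ (l.map α).sum) • l.foldr (fun j ψ => (D j)^[α j] ψ) (conjTest φ) := by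
    intro l
    induction l with
    | nil => simp
    | cons j l ih =>
      rw [List.foldr_cons, List.foldr_cons, conjTest_D_iterate, ih, D_iterate_smul, smul_smul,
        List.map_cons, List.sum_cons, pow_add]
  rw [multiD, multiD, h, ← List.ofFn_eq_map, List.sum_ofFn, Finsupp.degree_eq_sum]

/-- Each `D_j` changes sign under conjugation and the coefficients are real. This translates the
sesquilinear `L²` pairing into the bilinear pairing used for distributions. -/
theorem conj_diffOp (P : MvPolynomial (Fin n) ℝ) (φ : 𝓓(Ω, ℂ)) (x : Space n) :
    (starRingEnd ℂ) (diffOp P φ x) = diffOpTranspose P (conjTest φ) x := by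
  have h1 : ∀ (s : Finset (Fin n →₀ ℕ)) (c : (Fin n →₀ ℕ) → ℂ) (f : (Fin n →₀ ℕ) → 𝓓(Ω, ℂ)),
      (∑ α ∈ s, c α • f α) x = ∑ α ∈ s, c α * f α x := by
    intro s c f
    change toSchwartz (∑ α ∈ s, c α • f α) x = _
    rw [map_sum, sum_apply]
    rfl
  rw [diffOp, diffOpTranspose, h1, h1, map_sum]
  refine Finset.sum_congr rfl fun α _ => ?_
  rw [map_mul, Complex.conj_ofReal, ← conjTest_apply, conjTest_multiD]
  change _ * ((-1 : ℂ) ^ α.degree * _) = _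
  ring

/-! ### Hörmander's inequalities for the derivatives of the symbol -/

theorem totalDegree_pderiv_lt {σ : Type*} {P : MvPolynomial σ ℝ} (hP : 0 < P.totalDegree) (j : σ) :
    (pderiv j P).totalDegree < P.totalDegree := by
  classical
  rw [MvPolynomial.totalDegree, Finset.sup_lt_iff hP]
  intro m hm
  rw [MvPolynomial.mem_support_iff, MvPolynomial.coeff_pderiv] at hm
  have h : m + Finsupp.single j 1 ∈ P.support := by
    rw [MvPolynomial.mem_support_iff]
    intro h0
    simp [h0] at hm
  have := MvPolynomial.le_totalDegree h
  rw [Finsupp.sum_add_index' (by simp) (by simp)] at this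
  simp at this
  omega

theorem exists_pderiv_ne_zero {σ : Type*} {P : MvPolynomial σ ℝ} (hP : 0 < P.totalDegree) :
    ∃ j, pderiv j P ≠ 0 := by
  classical
  have hne : P.totalDegree ≠ 0 := hP.ne'
  rw [ne_eq, MvPolynomial.totalDegree_eq_zero_iff] at hne
  push Not at hne
  obtain ⟨m, hm, j, hj⟩ := hne
  refine ⟨j, fun h0 => ?_⟩
  have h1 := congrArg (MvPolynomial.coeff (m - Finsupp.single j 1)) h0
  have hle : Finsupp.single j 1 ≤ m := by
    rw [Finsupp.single_le_iff]
    omega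
  rw [MvPolynomial.coeff_pderiv, tsub_add_cancel_of_le hle, MvPolynomial.coeff_zero] at h1
  rw [MvPolynomial.mem_support_iff] at hm
  refine mul_ne_zero hm ?_ h1
  positivity

theorem hasLineDerivAt_symb (P : MvPolynomial (Fin n) ℝ) (j : Fin n) (ξ : Space n) :
    HasLineDerivAt ℝ (symb P) (2 * Real.pi * symb (pderiv j P) ξ) ξ
      (EuclideanSpace.single j 1) := by
  unfold HasLineDerivAt symb
  induction P using MvPolynomial.induction_on with
  | C a => simpa using hasDerivAt_const (0 : ℝ) a
  | add p q hp hq => simpa [mul_add] using! hp.add hq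
  | mul_X p i hp =>
    have hi : HasDerivAt (fun t : ℝ => 2 * Real.pi * (ξ + t • EuclideanSpace.single j (1 : ℝ)) i)
        (2 * Real.pi * (if i = j then 1 else 0)) 0 := by
      have : HasDerivAt (fun t : ℝ => 2 * Real.pi * (ξ i + t * (if i = j then 1 else 0)))
          (2 * Real.pi * (if i = j then 1 else 0)) 0 := by
        simpa using (((hasDerivAt_id (0 : ℝ)).mul_const (if i = j then (1 : ℝ) else 0)).const_add
          (ξ i)).const_mul (2 * Real.pi)
      convert this using 2
      simp
    have h := hp.mul hi
    simp only [map_mul, MvPolynomial.eval_X]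
    convert! h using 1
    rw [Derivation.leibniz, MvPolynomial.pderiv_X]
    simp only [Pi.single_apply, smul_eq_mul, map_add, map_mul, MvPolynomial.eval_X, zero_smul,
      add_zero]
    by_cases hij : i = j
    · simp [hij]; ring
    · simp [hij]; ring

/-- The Leibniz rule for the product of a symbol and a Schwartz function. -/
theorem lineDeriv_mulSymb (P : MvPolynomial (Fin n) ℝ) (j : Fin n) (g : 𝓢(Space n, ℂ)) :
    ∂_{EuclideanSpace.single j (1 : ℝ)} (mulSymb P g)
      = mulSymb P (∂_{EuclideanSpace.single j (1 : ℝ)} g)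
        + ((2 * Real.pi : ℝ) : ℂ) • mulSymb (pderiv j P) g := by
  ext ξ
  rw [SchwartzMap.lineDerivOp_apply, add_apply, smul_apply, mulSymb_apply, mulSymb_apply,
    SchwartzMap.lineDerivOp_apply]
  have hg : HasLineDerivAt ℝ g (lineDeriv ℝ g ξ (EuclideanSpace.single j 1)) ξ
      (EuclideanSpace.single j 1) :=
    (g.differentiableAt.lineDifferentiableAt).hasLineDerivAt
  have hP := hasLineDerivAt_symb P j ξ
  have h : HasLineDerivAt ℝ (mulSymb P g)
      (symb P ξ * lineDeriv ℝ g ξ (EuclideanSpace.single j 1)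
        + ((2 * Real.pi * symb (pderiv j P) ξ : ℝ) : ℂ) * g ξ) ξ (EuclideanSpace.single j 1) := by
    unfold HasLineDerivAt at *
    have := (hP.ofReal_comp).mul hg
    simp only [zero_smul, add_zero] at this
    rw [add_comm] at this
    refine this.congr_of_eventuallyEq (Eventually.of_forall fun t => ?_)
    simp
  rw [h.lineDeriv, smul_eq_mul]
  push_cast
  ring

/-- The Schwartz functions `g` for which `‖∂_j (Q g)‖ ≤ A ‖Q g‖` in `L²`, for all symbols `Q`. -/
def BernsteinClass (A : ℝ) (g : 𝓢(Space n, ℂ)) : Prop :=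
  ∀ (j : Fin n) (Q : MvPolynomial (Fin n) ℝ),
    ‖(∂_{EuclideanSpace.single j (1 : ℝ)} (mulSymb Q g)).toLp 2‖ ≤ A * ‖(mulSymb Q g).toLp 2‖

/-- Differentiating `𝓕 φ` in `ξ_j` amounts to multiplying `φ` by `-2πi x_j`, and `|x_j| ≤ A` where
`φ` does not vanish. -/
theorem norm_lineDeriv_fourier_le {A : ℝ} (hA : ∀ x ∈ Ω, ‖x‖ ≤ A) (j : Fin n) (φ : 𝓓(Ω, ℂ)) :
    ‖(∂_{EuclideanSpace.single j (1 : ℝ)} (𝓕 (toSchwartz φ))).toLp 2‖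
      ≤ 2 * Real.pi * A * ‖(𝓕 (toSchwartz φ)).toLp 2‖ := by
  have h' : (inner ℝ · (EuclideanSpace.single j (1 : ℝ)) : Space n → ℝ).HasTemperateGrowth := by
    fun_prop
  rw [SchwartzMap.lineDerivOp_fourier_eq, SchwartzMap.norm_fourier_toL2_eq,
    SchwartzMap.norm_fourier_toL2_eq]
  apply Lp.norm_le_mul_norm_of_ae_le_mul
  filter_upwards [SchwartzMap.coeFn_toLp (-(2 * Real.pi * Complex.I) • SchwartzMap.smulLeftCLM ℂ
    (inner ℝ · (EuclideanSpace.single j (1 : ℝ)) : Space n → ℝ) (toSchwartz φ)) 2 volume,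
    (toSchwartz φ).coeFn_toLp 2 volume] with x h1 h2
  rw [h1, h2, smul_apply, SchwartzMap.smulLeftCLM_apply_apply h', toSchwartz_apply]
  by_cases hx : φ x = 0
  · simp [hx]
  · have hxΩ : x ∈ Ω := φ.tsupport_subset (subset_tsupport _ hx)
    have hxA : |inner ℝ x (EuclideanSpace.single j (1 : ℝ))| ≤ A := by
      refine (abs_real_inner_le_norm _ _).trans ?_
      simpa using hA x hxΩ
    rw [norm_smul, norm_smul, ← mul_assoc]
    gcongr
    simp only [norm_neg, norm_mul, Complex.norm_I, Complex.norm_real, Real.norm_eq_abs,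
      abs_of_pos Real.pi_pos, Complex.norm_ofNat, mul_one]
    gcongr
    exact hxA

/-- `Q(D) φ` is again a test function on `Ω`, so a single constant serves all symbols `Q`. -/
theorem bernsteinClass_fourier {A : ℝ} (hA : ∀ x ∈ Ω, ‖x‖ ≤ A) (φ : 𝓓(Ω, ℂ)) :
    BernsteinClass (2 * Real.pi * A) (𝓕 (toSchwartz φ)) := by
  intro j Q
  rw [← fourier_diffOp]
  exact norm_lineDeriv_fourier_le hA j _

theorem toLp_add (f g : 𝓢(Space n, ℂ)) :
    (f + g).toLp 2 (volume : Measure (Space n)) = f.toLp 2 volume + g.toLp 2 volume :=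
  map_add (SchwartzMap.toLpCLM ℂ ℂ 2 volume) f g

theorem toLp_smul (c : ℂ) (g : 𝓢(Space n, ℂ)) :
    (c • g).toLp 2 (volume : Measure (Space n)) = c • g.toLp 2 volume :=
  map_smul (SchwartzMap.toLpCLM ℂ ℂ 2 volume) c g

theorem mulSymb_zero (g : 𝓢(Space n, ℂ)) : mulSymb 0 g = 0 := by
  ext ξ
  simp [symb]

theorem toLp_zero : (0 : 𝓢(Space n, ℂ)).toLp 2 (volume : Measure (Space n)) = 0 :=
  map_zero (SchwartzMap.toLpCLM ℂ ℂ 2 volume)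

theorem inner_mulSymb_mulSymb (P Q : MvPolynomial (Fin n) ℝ) (g h : 𝓢(Space n, ℂ)) :
    inner ℂ ((mulSymb P g).toLp 2) ((mulSymb Q h).toLp 2)
      = inner ℂ ((mulSymb Q g).toLp 2) ((mulSymb P h).toLp 2) := by
  simp only [SchwartzMap.inner_toL2_toL2_eq]
  congr 1
  ext ξ
  simp
  ring

/-- Here `v = P g`, `u = P' g`, `w = P'' g`, primes on `P` denoting `∂_j`, while `u'`, `v'` are `P'
∂_j g`, `P ∂_j g` and `du`, `dv` are `∂_j u`, `∂_j v`. Then `2π u` is the commutator `dv - v'`.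
Pairing it with `u` and moving the real symbols by `swap` replaces `⟨u, v'⟩` by `⟨v, du⟩ - 2π ⟨v,
w⟩`, and every remaining term is at most a constant times `‖u‖ ‖v‖`. -/
theorem norm_le_of_commutator {E : Type*} [NormedAddCommGroup E] [InnerProductSpace ℂ E]
    {A K : ℝ} (hA : 0 ≤ A) (hK : 0 ≤ K) {u v w u' v' du dv : E}
    (L1 : dv = v' + ((2 * Real.pi : ℝ) : ℂ) • u) (L2 : du = u' + ((2 * Real.pi : ℝ) : ℂ) • w)
    (B1 : ‖dv‖ ≤ A * ‖v‖) (B2 : ‖du‖ ≤ A * ‖u‖) (B3 : ‖w‖ ≤ K * ‖u‖)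
    (swap : inner ℂ u v' = inner ℂ v u') : ‖u‖ ≤ (A + K) * ‖v‖ := by
  have n1 := (norm_inner_le_norm (𝕜 := ℂ) u dv).trans
    (mul_le_mul_of_nonneg_left B1 (norm_nonneg _))
  have n2 := (norm_inner_le_norm (𝕜 := ℂ) v du).trans
    (mul_le_mul_of_nonneg_left B2 (norm_nonneg _))
  have n3 := (norm_inner_le_norm (𝕜 := ℂ) v w).trans
    (mul_le_mul_of_nonneg_left B3 (norm_nonneg _))
  rw [L1] at n1
  rw [L2] at n2
  have key : ((2 * Real.pi : ℝ) : ℂ) * (‖u‖ : ℂ) ^ 2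
      = inner ℂ u (v' + ((2 * Real.pi : ℝ) : ℂ) • u)
        - (inner ℂ v (u' + ((2 * Real.pi : ℝ) : ℂ) • w)
          - ((2 * Real.pi : ℝ) : ℂ) * inner ℂ v w) := by
    rw [inner_add_right, inner_add_right, inner_smul_right, inner_smul_right,
      inner_self_eq_norm_sq_to_K, swap]
    simp only [Complex.coe_algebraMap]
    ring
  have hbound : 2 * Real.pi * ‖u‖ ^ 2
      ≤ ‖u‖ * (A * ‖v‖) + (‖v‖ * (A * ‖u‖) + 2 * Real.pi * (‖v‖ * (K * ‖u‖))) := by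
    have hn : 2 * Real.pi * ‖u‖ ^ 2 = ‖((2 * Real.pi : ℝ) : ℂ) * (‖u‖ : ℂ) ^ 2‖ := by
      rw [norm_mul, norm_pow, Complex.norm_real, Complex.norm_real,
        Real.norm_of_nonneg (by positivity), norm_norm]
    rw [hn, key]
    refine (norm_sub_le _ _).trans (add_le_add n1 ((norm_sub_le _ _).trans (add_le_add n2 ?_)))
    rw [norm_mul, Complex.norm_real, Real.norm_of_nonneg (by positivity)]
    exact mul_le_mul_of_nonneg_left n3 (by positivity)
  clear key n1 n2 n3 swap L1 L2 B1 B2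
  generalize ‖v‖ = a, norm_nonneg v = ha0 at *
  generalize ‖u‖ = b, norm_nonneg u = hb0 at *
  rcases hb0.eq_or_lt with h | h
  · rw [← h]
    positivity
  · have h2 : 2 * Real.pi * b ≤ 2 * A * a + 2 * Real.pi * K * a := by
      refine le_of_mul_le_mul_right ?_ h
      linarith
    have hpi := Real.pi_gt_three
    -- This only rounds the constant `A / π + K` up to `A + K`.
    have : 2 * A * a ≤ 2 * Real.pi * A * a := by
      have := mul_nonneg hA ha0
      nlinarith
    refine le_of_mul_le_mul_left (a := 2 * Real.pi) ?_ (by positivity)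
    linarith

/-- Hörmander's inequality: `∂_j P` is dominated by `P`. -/
theorem exists_norm_pderiv_le {A : ℝ} (hA : 0 ≤ A) (j : Fin n) (P : MvPolynomial (Fin n) ℝ) :
    ∃ K, 0 ≤ K ∧ ∀ g : 𝓢(Space n, ℂ), BernsteinClass A g →
      ‖(mulSymb (pderiv j P) g).toLp 2‖ ≤ K * ‖(mulSymb P g).toLp 2‖ := by
  induction hd : P.totalDegree using Nat.strong_induction_on generalizing P with
  | _ d ih =>
  rcases Nat.eq_zero_or_pos P.totalDegree with h0 | hpos
  · rw [MvPolynomial.totalDegree_eq_zero_iff_eq_C] at h0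
    refine ⟨0, le_rfl, fun g _ => ?_⟩
    rw [h0, MvPolynomial.pderiv_C, mulSymb_zero, toLp_zero]
    simp
  -- The commutator estimate needs `∂_j² P` bounded by `∂_j P`, which is the same inequality in
  -- lower degree.
  obtain ⟨K, hK, hPK⟩ := ih _ (hd ▸ totalDegree_pderiv_lt hpos j) (pderiv j P) rfl
  refine ⟨A + K, by positivity, fun g hg => ?_⟩
  set e : Space n := EuclideanSpace.single j (1 : ℝ) with he
  have L1 := congrArg (fun f : 𝓢(Space n, ℂ) => f.toLp 2 (volume : Measure (Space n)))
    (lineDeriv_mulSymb P j g)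
  have L2 := congrArg (fun f : 𝓢(Space n, ℂ) => f.toLp 2 (volume : Measure (Space n)))
    (lineDeriv_mulSymb (pderiv j P) j g)
  simp only [toLp_add, toLp_smul, ← he] at L1 L2
  have B1 := hg j P
  have B2 := hg j (pderiv j P)
  rw [← he] at B1 B2
  exact norm_le_of_commutator hA hK L1 L2 B1 B2 (hPK g hg)
    (inner_mulSymb_mulSymb (pderiv j P) P g (∂_{e} g))

theorem exists_norm_multiPderiv_le {A : ℝ} (hA : 0 ≤ A) (P : MvPolynomial (Fin n) ℝ)
    (α : Fin n → ℕ) :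
    ∃ K, 0 ≤ K ∧ ∀ g : 𝓢(Space n, ℂ), BernsteinClass A g →
      ‖(mulSymb (multiPderiv α P) g).toLp 2‖ ≤ K * ‖(mulSymb P g).toLp 2‖ := by
  have hiter : ∀ (j : Fin n) (k : ℕ) (Q : MvPolynomial (Fin n) ℝ), ∃ K, 0 ≤ K ∧
      ∀ g : 𝓢(Space n, ℂ), BernsteinClass A g →
        ‖(mulSymb ((pderiv j)^[k] Q) g).toLp 2‖ ≤ K * ‖(mulSymb Q g).toLp 2‖ := by
    intro j k Q
    induction k with
    | zero => exact ⟨1, zero_le_one, fun g _ => by simp⟩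
    | succ k ih =>
      obtain ⟨K, hK, h⟩ := ih
      obtain ⟨K', hK', h'⟩ := exists_norm_pderiv_le hA j ((pderiv j)^[k] Q)
      refine ⟨K' * K, by positivity, fun g hg => ?_⟩
      rw [Function.iterate_succ_apply', mul_assoc]
      exact (h' g hg).trans (by gcongr; exact h g hg)
  unfold multiPderiv
  induction List.finRange n with
  | nil => exact ⟨1, zero_le_one, fun g _ => by simp⟩
  | cons j l ih =>
    obtain ⟨K, hK, h⟩ := ih
    rw [List.foldr_cons]
    obtain ⟨K', hK', h'⟩ :=
      hiter j (α j) (l.foldr (fun j Q => (pderiv j)^[α j] Q) P)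
    refine ⟨K' * K, by positivity, fun g hg => ?_⟩
    rw [mul_assoc]
    exact (h' g hg).trans (by gcongr; exact h g hg)

/-- Some chain of derivatives leads from `P` to a nonzero constant, and each differentiation costs
only a constant factor. -/
theorem exists_norm_le_mulSymb {A : ℝ} (hA : 0 ≤ A) {P : MvPolynomial (Fin n) ℝ} (hP : P ≠ 0) :
    ∃ K, 0 ≤ K ∧ ∀ g : 𝓢(Space n, ℂ), BernsteinClass A g →
      ‖g.toLp 2 (volume : Measure (Space n))‖ ≤ K * ‖(mulSymb P g).toLp 2‖ := by
  induction hd : P.totalDegree using Nat.strong_induction_on generalizing P with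
  | _ d ih =>
  rcases Nat.eq_zero_or_pos P.totalDegree with h0 | hpos
  · rw [MvPolynomial.totalDegree_eq_zero_iff_eq_C] at h0
    generalize P.coeff 0 = c at h0
    have hc : c ≠ 0 := by
      rintro rfl
      simp [h0] at hP
    refine ⟨|c|⁻¹, by positivity, fun g _ => ?_⟩
    have : mulSymb P g = (c : ℂ) • g := by
      ext ξ
      simp [h0, symb]
    rw [this, toLp_smul, norm_smul, Complex.norm_real, Real.norm_eq_abs,
      inv_mul_cancel_left₀ (abs_ne_zero.2 hc)]
  · obtain ⟨j, hj⟩ := exists_pderiv_ne_zero hpos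
    obtain ⟨K, hK, h⟩ := ih _ (hd ▸ totalDegree_pderiv_lt hpos j) hj rfl
    obtain ⟨K', hK', h'⟩ := exists_norm_pderiv_le hA j P
    refine ⟨K * K', by positivity, fun g hg => ?_⟩
    rw [mul_assoc]
    exact (h g hg).trans (by gcongr; exact h' g hg)

/-! ### The weighted inequality and compactness of the embedding -/

theorem integrable_norm_sq (g : 𝓢(Space n, ℂ)) : Integrable (fun ξ => ‖g ξ‖ ^ 2) volume :=
  (g.memLp 2 volume).integrable_norm_pow (by norm_num)

theorem norm_sq_toLp (g : 𝓢(Space n, ℂ)) :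
    ‖g.toLp 2 (volume : Measure (Space n))‖ ^ 2 = ∫ ξ, ‖g ξ‖ ^ 2 := by
  have h := SchwartzMap.inner_toL2_toL2_eq g g volume
  simp only [inner_self_eq_norm_sq_to_K, Complex.coe_algebraMap] at h
  have h2 : ((∫ ξ, ‖g ξ‖ ^ 2 : ℝ) : ℂ) = (‖g.toLp 2 (volume : Measure (Space n))‖ : ℂ) ^ 2 := by
    rw [h, ← integral_complex_ofReal]
    simp
  exact_mod_cast h2.symm

theorem symbolTilde_sq (P : MvPolynomial (Fin n) ℝ) (ξ : Space n) :
    symbolTilde P ((2 * Real.pi) • ξ) ^ 2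
      = ∑ α : Fin n → Fin (P.totalDegree + 1),
          symb (multiPderiv (fun j => (α j : ℕ)) P) ξ ^ 2 := by
  rw [symbolTilde, Real.sq_sqrt (Finset.sum_nonneg fun _ _ => sq_nonneg _)]
  rfl

theorem symbolTilde_sq_mul (P : MvPolynomial (Fin n) ℝ) (g : 𝓢(Space n, ℂ)) (ξ : Space n) :
    symbolTilde P ((2 * Real.pi) • ξ) ^ 2 * ‖g ξ‖ ^ 2
      = ∑ α : Fin n → Fin (P.totalDegree + 1),
          ‖mulSymb (multiPderiv (fun j => (α j : ℕ)) P) g ξ‖ ^ 2 := by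
  rw [symbolTilde_sq, Finset.sum_mul]
  refine Finset.sum_congr rfl fun α _ => ?_
  rw [mulSymb_apply, norm_mul, mul_pow, Complex.norm_real, Real.norm_eq_abs, sq_abs]

theorem integrable_symbolTilde_sq_mul (P : MvPolynomial (Fin n) ℝ) (g : 𝓢(Space n, ℂ)) :
    Integrable (fun ξ => symbolTilde P ((2 * Real.pi) • ξ) ^ 2 * ‖g ξ‖ ^ 2) volume := by
  simp_rw [symbolTilde_sq_mul]
  exact integrable_finsetSum _ fun α _ => integrable_norm_sq _

/-- The weighted inequality `∫ P̃² |g|² ≤ K ‖P g‖²`. -/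
theorem exists_integral_symbolTilde_le {A : ℝ} (hA : 0 ≤ A) (P : MvPolynomial (Fin n) ℝ) :
    ∃ K, 0 ≤ K ∧ ∀ g : 𝓢(Space n, ℂ), BernsteinClass A g →
      ∫ ξ, symbolTilde P ((2 * Real.pi) • ξ) ^ 2 * ‖g ξ‖ ^ 2
        ≤ K * ‖(mulSymb P g).toLp 2‖ ^ 2 := by
  choose K hK h using fun α : Fin n → Fin (P.totalDegree + 1) =>
    exists_norm_multiPderiv_le hA P (fun j => (α j : ℕ))
  refine ⟨∑ α, K α ^ 2, Finset.sum_nonneg fun _ _ => sq_nonneg _, fun g hg => ?_⟩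
  simp_rw [symbolTilde_sq_mul]
  rw [integral_finsetSum _ fun α _ => integrable_norm_sq _, Finset.sum_mul]
  refine Finset.sum_le_sum fun α _ => ?_
  rw [← norm_sq_toLp, ← mul_pow]
  exact pow_le_pow_left₀ (norm_nonneg _) (h α g hg) 2

/-- The character `x ↦ e^{2πi x·ξ}` cut off to `Ω`. -/
def cutChar (Ω : Opens (Space n)) (ξ : Space n) : Space n → ℂ :=
  (Ω : Set (Space n)).indicator fun x => Circle.coeHom (Real.fourierChar (inner ℝ x ξ))

theorem memLp_cutChar (hΩ : Bornology.IsBounded (Ω : Set (Space n))) (ξ : Space n) :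
    MemLp (cutChar Ω ξ) 2 volume := by
  rw [cutChar, memLp_indicator_iff_restrict Ω.isOpen.measurableSet]
  have : IsFiniteMeasure (volume.restrict (Ω : Set (Space n))) :=
    ⟨by simpa using hΩ.measure_lt_top⟩
  have hc : Continuous fun x : Space n => Circle.coeHom (Real.fourierChar (inner ℝ x ξ)) :=
    continuous_subtype_val.comp (Real.continuous_fourierChar.comp (by fun_prop))
  refine MemLp.of_bound hc.aestronglyMeasurable 1 ?_
  exact Eventually.of_forall fun x => (Circle.norm_coe _).le

theorem norm_cutChar (hΩ : Bornology.IsBounded (Ω : Set (Space n))) (ξ : Space n) :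
    ‖(memLp_cutChar hΩ ξ).toLp‖ = ‖(memLp_cutChar hΩ 0).toLp‖ := by
  rw [Lp.norm_toLp, Lp.norm_toLp]
  congr 1
  refine eLpNorm_congr_norm_ae (Eventually.of_forall fun x => ?_)
  by_cases hx : x ∈ (Ω : Set (Space n))
  · simp only [cutChar, Set.indicator_of_mem hx]
    exact (Circle.norm_coe _).trans (Circle.norm_coe _).symm
  · simp only [cutChar, Set.indicator_of_notMem hx]

/-- As `φ` vanishes off the bounded set `Ω`, the value of its transform at `ξ` is a bounded
functional on `L²`. Weak convergence therefore yields pointwise convergence of the transforms. -/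
theorem fourier_eq_inner_cutChar (hΩ : Bornology.IsBounded (Ω : Set (Space n))) (φ : 𝓓(Ω, ℂ))
    (ξ : Space n) :
    𝓕 (toSchwartz φ) ξ = inner ℂ (memLp_cutChar hΩ ξ).toLp (toL2 φ) := by
  rw [L2.inner_def, SchwartzMap.fourier_coe, Real.fourier_eq]
  refine integral_congr_ae ?_
  filter_upwards [(memLp_cutChar hΩ ξ).coeFn_toLp, coeFn_toL2 φ] with x h1 h2
  rw [h1, h2, toSchwartz_apply, RCLike.inner_apply]
  by_cases hx : x ∈ (Ω : Set (Space n))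
  · rw [cutChar, Set.indicator_of_mem hx, Circle.smul_def, smul_eq_mul, mul_comm,
      AddChar.map_neg_eq_inv, Circle.coe_inv_eq_conj]
    rfl
  · have : φ x = 0 := by
      by_contra h
      exact hx (φ.tsupport_subset (subset_tsupport _ h))
    simp [this]

/-- Compactness of the embedding of `H^P_0(Ω)` into `L²`. -/
theorem tendsto_toL2_zero (hΩ : Bornology.IsBounded (Ω : Set (Space n)))
    {P : MvPolynomial (Fin n) ℝ}
    (hP : Tendsto (symbolTilde P) (Bornology.cobounded (Space n)) atTop)
    {φ : ℕ → 𝓓(Ω, ℂ)} {M : ℝ} (hM : ∀ k, ‖toL2 (diffOp P (φ k))‖ ≤ M)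
    (hφ : WeaklyNull fun k => toL2 (φ k)) :
    Tendsto (fun k => toL2 (φ k)) atTop (𝓝 0) := by
  obtain ⟨A, hA0, hA⟩ := hΩ.exists_pos_norm_le
  obtain ⟨K, hK, hbound⟩ :=
    exists_integral_symbolTilde_le (A := 2 * Real.pi * A) (by positivity) P
  obtain ⟨B, hB⟩ := hφ.1
  set g : ℕ → 𝓢(Space n, ℂ) := fun k => 𝓕 (toSchwartz (φ k)) with hg
  have hpt : ∀ ξ, Tendsto (fun k => g k ξ) atTop (𝓝 0) := by
    intro ξ
    simp_rw [hg, fourier_eq_inner_cutChar hΩ]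
    exact hφ.2 _
  set c := ‖(memLp_cutChar hΩ 0).toLp‖ with hc
  -- All cut-off characters have the same norm, so the bound is uniform in `ξ` and can serve as a
  -- dominating constant.
  have hunif : ∀ k ξ, ‖g k ξ‖ ≤ c * B := by
    intro k ξ
    rw [hg, fourier_eq_inner_cutChar hΩ, hc, ← norm_cutChar hΩ ξ]
    exact (norm_inner_le_norm _ _).trans (mul_le_mul_of_nonneg_left (hB k) (norm_nonneg _))
  have hweight : ∀ k, ∫ ξ, symbolTilde P ((2 * Real.pi) • ξ) ^ 2 * ‖g k ξ‖ ^ 2 ≤ K * M ^ 2 := by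
    intro k
    refine (hbound _ (bernsteinClass_fourier hA (φ k))).trans ?_
    rw [← norm_toL2_diffOp]
    exact mul_le_mul_of_nonneg_left (pow_le_pow_left₀ (norm_nonneg _) (hM k) 2) hK
  have hsq : Tendsto (fun k => ‖toL2 (φ k)‖ ^ 2) atTop (𝓝 0) := by
    simp_rw [norm_toL2, norm_sq_toLp]
    rw [Metric.tendsto_atTop']
    intro ε hε
    -- `s` is the threshold for `P̃` beyond which the frequencies contribute less than `ε / 2`; `1 ≤
    -- s` lets `s ≤ P̃` imply `s ≤ P̃²`.
    obtain ⟨s, hs1, hs⟩ : ∃ s : ℝ, 1 ≤ s ∧ K * M ^ 2 / s < ε / 2 := by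
      refine ⟨max 1 (2 * (K * M ^ 2 + 1) / ε), le_max_left _ _, ?_⟩
      have h1 : 2 * (K * M ^ 2 + 1) / ε ≤ max 1 (2 * (K * M ^ 2 + 1) / ε) := le_max_right _ _
      have h0 : (0 : ℝ) < max 1 (2 * (K * M ^ 2 + 1) / ε) := lt_max_of_lt_left one_pos
      rw [div_le_iff₀ hε] at h1
      rw [div_lt_iff₀ h0]
      linarith
    have hs0 : 0 < s := one_pos.trans_le hs1
    obtain ⟨R, hR⟩ : ∃ R, ∀ ξ : Space n, R < ‖ξ‖ → s ≤ symbolTilde P ((2 * Real.pi) • ξ) := by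
      have h2 := hP.eventually (eventually_ge_atTop s)
      rw [← comap_norm_atTop, eventually_comap, eventually_atTop] at h2
      obtain ⟨R, hR⟩ := h2
      refine ⟨|R|, fun ξ hξ => hR _ ?_ _ rfl⟩
      rw [norm_smul, Real.norm_of_nonneg (by positivity)]
      have := Real.pi_gt_three
      nlinarith [norm_nonneg ξ, le_abs_self R]
    have hball : Tendsto (fun k => ∫ ξ in Metric.closedBall (0 : Space n) R, ‖g k ξ‖ ^ 2) atTop
        (𝓝 0) := by
      have hfin : IsFiniteMeasure
          ((volume : Measure (Space n)).restrict (Metric.closedBall 0 R)) :=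
        ⟨by simpa using measure_closedBall_lt_top⟩
      have := tendsto_integral_of_dominated_convergence
        (μ := (volume : Measure (Space n)).restrict (Metric.closedBall 0 R))
        (F := fun k ξ => ‖g k ξ‖ ^ 2) (f := fun _ => 0) (fun _ => (c * B) ^ 2)
        (fun k => (integrable_norm_sq (g k)).aestronglyMeasurable.restrict)
        (integrable_const _)
        (fun k => Eventually.of_forall fun ξ => by
          rw [Real.norm_of_nonneg (by positivity)]
          exact pow_le_pow_left₀ (norm_nonneg _) (hunif k ξ) 2)
        (Eventually.of_forall fun ξ => by simpa using ((hpt ξ).norm.pow 2))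
      simpa using this
    obtain ⟨N, hN⟩ := eventually_atTop.1 (hball.eventually (gt_mem_nhds (half_pos hε)))
    refine ⟨N, fun k hk => ?_⟩
    rw [Real.dist_eq, sub_zero, abs_of_nonneg (integral_nonneg fun _ => by positivity)]
    have hmeas : MeasurableSet (Metric.closedBall (0 : Space n) R) :=
      Metric.isClosed_closedBall.measurableSet
    -- Frequencies are split at radius `R`: inside, the indicator carries the integrand; outside, `1
    -- ≤ s⁻¹ P̃²`.
    have hle : ∫ ξ, ‖g k ξ‖ ^ 2
        ≤ ∫ ξ, ((Metric.closedBall (0 : Space n) R).indicator (fun ξ => ‖g k ξ‖ ^ 2) ξ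
          + s⁻¹ * (symbolTilde P ((2 * Real.pi) • ξ) ^ 2 * ‖g k ξ‖ ^ 2)) := by
      refine integral_mono (integrable_norm_sq _) (((integrable_norm_sq _).indicator hmeas).add
        ((integrable_symbolTilde_sq_mul P _).const_mul _)) fun ξ => ?_
      by_cases hξ : ξ ∈ Metric.closedBall (0 : Space n) R
      · simp only [Set.indicator_of_mem hξ, le_add_iff_nonneg_right]
        positivity
      · simp only [Set.indicator_of_notMem hξ, zero_add]
        have h1 : s ≤ symbolTilde P ((2 * Real.pi) • ξ) := hR ξ (by simpa using hξ)
        have h2 : s ≤ symbolTilde P ((2 * Real.pi) • ξ) ^ 2 := by nlinarith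
        rw [← mul_assoc]
        refine le_mul_of_one_le_left (by positivity) ?_
        rw [inv_mul_eq_div, one_le_div hs0]
        exact h2
    rw [integral_add ((integrable_norm_sq _).indicator hmeas)
      ((integrable_symbolTilde_sq_mul P _).const_mul _), integral_indicator hmeas,
      integral_const_mul] at hle
    have h3 : s⁻¹ * ∫ ξ, symbolTilde P ((2 * Real.pi) • ξ) ^ 2 * ‖g k ξ‖ ^ 2 ≤ K * M ^ 2 / s := by
      rw [inv_mul_eq_div]
      exact div_le_div_of_nonneg_right (hweight k) hs0.le
    have := hN k hk.le
    linarith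
  rw [tendsto_zero_iff_norm_tendsto_zero]
  simpa using hsq.sqrt

/-- This Poincaré-type inequality bounds `q` by `p` and shows that `u = 0` once `P u = 0`. -/
theorem exists_norm_toL2_le (hΩ : Bornology.IsBounded (Ω : Set (Space n)))
    {P : MvPolynomial (Fin n) ℝ} (hP : P ≠ 0) :
    ∃ K, 0 ≤ K ∧ ∀ φ : 𝓓(Ω, ℂ), ‖toL2 φ‖ ≤ K * ‖toL2 (diffOp P φ)‖ := by
  obtain ⟨A, hA0, hA⟩ := hΩ.exists_pos_norm_le
  obtain ⟨K, hK, h⟩ := exists_norm_le_mulSymb (A := 2 * Real.pi * A) (by positivity) hP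
  refine ⟨K, hK, fun φ => ?_⟩
  rw [norm_toL2, norm_toL2_diffOp]
  exact h _ (bernsteinClass_fourier hA φ)

/-! ### From distributions on the domain to identities in `L²` -/

/-- Multiplication by a bounded real function on `L²(ℝⁿ)`. -/
def mulOp {m : Space n → ℝ} (hm : MemLp m ∞ volume) :
    Lp ℂ 2 (volume : Measure (Space n)) →L[ℂ] Lp ℂ 2 (volume : Measure (Space n)) :=
  (ContinuousLinearMap.mul ℂ ℂ).holderL volume ∞ 2 2 (hm.ofReal (K := ℂ)).toLp

theorem coeFn_mulOp {m : Space n → ℝ} (hm : MemLp m ∞ volume)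
    (f : Lp ℂ 2 (volume : Measure (Space n))) :
    mulOp hm f =ᵐ[volume] fun x => (m x : ℂ) * f x := by
  filter_upwards [(ContinuousLinearMap.mul ℂ ℂ).coeFn_holder (r := 2) (hm.ofReal (K := ℂ)).toLp f,
    (hm.ofReal (K := ℂ)).coeFn_toLp] with x h1 h2
  change ((ContinuousLinearMap.mul ℂ ℂ).holder 2 (hm.ofReal (K := ℂ)).toLp f) x = _
  rw [h1, h2]
  rfl

theorem apply_eq_zero_of_notMem (φ : 𝓓(Ω, ℂ)) {x : Space n} (hx : x ∉ Ω) : φ x = 0 := by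
  by_contra h
  exact hx (φ.tsupport_subset (subset_tsupport _ h))

theorem norm_toL2_eq_eLpNorm (φ : 𝓓(Ω, ℂ)) : ‖toL2 φ‖ = (eLpNorm φ 2 volume).toReal := by
  rw [Lp.norm_def, eLpNorm_congr_ae (coeFn_toL2 φ)]

theorem cauchySeq_toL2_diffOp {P : MvPolynomial (Fin n) ℝ} {φ : ℕ → 𝓓(Ω, ℂ)}
    (h : Tendsto (fun p : ℕ × ℕ => eLpNorm (diffOp P (φ p.1 - φ p.2)) 2 volume) atTop (𝓝 0)) :
    CauchySeq fun k => toL2 (diffOp P (φ k)) := by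
  rw [cauchySeq_iff_tendsto_dist_atTop_0]
  have h1 := (ENNReal.tendsto_toReal ENNReal.zero_ne_top).comp h
  refine h1.congr fun p => ?_
  rw [Function.comp_apply, dist_eq_norm, ← norm_toL2_eq_eLpNorm, ← map_sub]
  simp only [← diffOpLin_apply, map_sub]

theorem tendsto_toL2_indicator {u : Space n → ℂ} {φ : ℕ → 𝓓(Ω, ℂ)}
    (hu : MemLp ((Ω : Set (Space n)).indicator u) 2 volume)
    (h : Tendsto (fun k => eLpNorm (fun x => φ k x - u x) 2
      (volume.restrict (Ω : Set (Space n)))) atTop (𝓝 0)) :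
    Tendsto (fun k => toL2 (φ k)) atTop (𝓝 hu.toLp) := by
  rw [tendsto_iff_norm_sub_tendsto_zero]
  have h1 := (ENNReal.tendsto_toReal ENNReal.zero_ne_top).comp h
  refine h1.congr fun k => ?_
  rw [Function.comp_apply, Lp.norm_def,
    ← eLpNorm_indicator_eq_eLpNorm_restrict Ω.isOpen.measurableSet]
  congr 1
  refine eLpNorm_congr_ae ?_
  filter_upwards [Lp.coeFn_sub (toL2 (φ k)) hu.toLp, coeFn_toL2 (φ k), hu.coeFn_toLp]
    with x h1 h2 h3
  rw [h1, Pi.sub_apply, h2, h3]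
  by_cases hx : x ∈ (Ω : Set (Space n))
  · simp [hx]
  · simp [hx, apply_eq_zero_of_notMem (φ k) hx]

/-- The product of an `L²_loc` function, a bounded function and a test function is integrable. -/
theorem MemL2Loc.integrable_mul {u : Space n → ℂ} (hu : MemL2Loc Ω u) {m : Space n → ℝ}
    (hm : MemLp m ∞ volume) (φ : 𝓓(Ω, ℂ)) :
    IntegrableOn (fun x => u x * ((m x : ℂ) * φ x)) Ω volume := by
  have hK : IsCompact (tsupport φ) := φ.hasCompactSupport
  have h1 : MemLp u 2 (volume.restrict (tsupport φ)) := hu _ hK φ.tsupport_subset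
  have hφ : MemLp φ 2 (volume : Measure (Space n)) := (toSchwartz φ).memLp 2 volume
  have h2 : MemLp (fun x => (m x : ℂ) * φ x) 2 (volume.restrict (tsupport φ)) :=
    (hφ.mul (r := 2) (hm.ofReal (K := ℂ))).restrict _
  have h3 : IntegrableOn (fun x => u x * ((m x : ℂ) * φ x)) (tsupport φ) volume :=
    h1.integrable_mul h2
  refine h3.of_forall_sdiff_eq_zero Ω.isOpen.measurableSet fun x hx => ?_
  rw [image_eq_zero_of_notMem_tsupport hx.2, mul_zero, mul_zero]

theorem MemL2Loc.integrable_mul_test {u : Space n → ℂ} (hu : MemL2Loc Ω u) (φ : 𝓓(Ω, ℂ)) :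
    IntegrableOn (fun x => u x * φ x) Ω volume := by
  simpa using hu.integrable_mul (memLp_top_const (1 : ℝ)) φ

theorem MemL2Loc.locallyIntegrableOn {u : Space n → ℂ} (hu : MemL2Loc Ω u) {m : Space n → ℝ}
    (hm : MemLp m ∞ volume) :
    LocallyIntegrableOn (fun x => (m x : ℂ) * u x) Ω volume := by
  rw [locallyIntegrableOn_iff Ω.isOpen.isLocallyClosed]
  intro K hKΩ hK
  have : IsFiniteMeasure (volume.restrict K : Measure (Space n)) :=
    ⟨by simpa using hK.measure_lt_top⟩
  exact ((hu K hK hKΩ).mul (r := 2) ((hm.ofReal (K := ℂ)).restrict K)).integrable one_le_two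

/-- Passage to the limit in `⟨P ψ, φ_k⟩ = ⟨ψ, P φ_k⟩`. -/
theorem inner_diffOp_of_tendsto {P : MvPolynomial (Fin n) ℝ} {φ : ℕ → 𝓓(Ω, ℂ)}
    {u f : Lp ℂ 2 (volume : Measure (Space n))}
    (hu : Tendsto (fun k => toL2 (φ k)) atTop (𝓝 u))
    (hf : Tendsto (fun k => toL2 (diffOp P (φ k))) atTop (𝓝 f)) (ψ : 𝓓(Ω, ℂ)) :
    inner ℂ (toL2 (diffOp P ψ)) u = inner ℂ (toL2 ψ) f := by
  have h1 : Tendsto (fun k => inner ℂ (toL2 (diffOp P ψ)) (toL2 (φ k))) atTop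
      (𝓝 (inner ℂ (toL2 (diffOp P ψ)) u)) := tendsto_const_nhds.inner hu
  have h2 : Tendsto (fun k => inner ℂ (toL2 ψ) (toL2 (diffOp P (φ k)))) atTop
      (𝓝 (inner ℂ (toL2 ψ) f)) := tendsto_const_nhds.inner hf
  refine tendsto_nhds_unique h1 (h2.congr fun k => ?_)
  rw [inner_diffOp]

theorem inner_toL2_eq_setIntegral (ψ : 𝓓(Ω, ℂ)) {f : Lp ℂ 2 (volume : Measure (Space n))}
    {f' : Space n → ℂ} (hf : ∀ᵐ x, x ∈ Ω → f x = f' x) :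
    inner ℂ (toL2 ψ) f = ∫ x in (Ω : Set (Space n)), f' x * (starRingEnd ℂ) (ψ x) := by
  rw [L2.inner_def, ← integral_indicator Ω.isOpen.measurableSet]
  refine integral_congr_ae ?_
  filter_upwards [hf, coeFn_toL2 ψ] with x h1 h2
  rw [h2, RCLike.inner_apply]
  by_cases hx : x ∈ (Ω : Set (Space n))
  · rw [h1 hx, Set.indicator_of_mem hx]
  · rw [Set.indicator_of_notMem hx, apply_eq_zero_of_notMem ψ hx]
    simp

/-- A distribution on `Ω` given by a locally integrable function determines the function. -/
theorem ae_eq_zero_of_integral_mul_test {G : Space n → ℂ} (hG : LocallyIntegrableOn G Ω volume)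
    (h : ∀ φ : 𝓓(Ω, ℂ), ∫ x in (Ω : Set (Space n)), G x * φ x = 0) :
    ∀ᵐ x, x ∈ Ω → G x = 0 := by
  refine Ω.isOpen.ae_eq_zero_of_integral_contDiff_smul_eq_zero hG fun g hg hc hs => ?_
  have hs' : tsupport (fun x => (g x : ℂ)) ⊆ Ω :=
    (tsupport_comp_subset (g := fun y : ℝ => (y : ℂ)) (by simp) g).trans hs
  let φ : 𝓓(Ω, ℂ) := ⟨fun x => (g x : ℂ), Complex.ofRealCLM.contDiff.comp hg,
    hc.comp_left (g := fun y : ℝ => (y : ℂ)) (by simp), hs'⟩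
  rw [← h φ, ← integral_indicator Ω.isOpen.measurableSet]
  refine integral_congr_ae (Eventually.of_forall fun x => ?_)
  have hφ : φ x = (g x : ℂ) := rfl
  by_cases hx : x ∈ (Ω : Set (Space n))
  · simp only [Set.indicator_of_mem hx, hφ, Complex.real_smul, mul_comm]
  · have : φ x = 0 := apply_eq_zero_of_notMem φ hx
    rw [hφ] at this
    simp only [Set.indicator_of_notMem hx, Complex.real_smul, this, zero_mul]

/-- The difference `u = v - w` of the two solutions satisfies `P(D) u = λ u - λ V w`. -/
theorem ae_eq_of_weakSolution {P : MvPolynomial (Fin n) ℝ} {V : Space n → ℝ}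
    (hV : MemLp V ∞ volume) {lam : ℂ} {v w : Space n → ℂ} (hv : MemL2Loc Ω v) (hw : MemL2Loc Ω w)
    (hvs : WeakSolution P Ω lam (fun _ => 1) v)
    (hws : WeakSolution P Ω lam (fun x => 1 + V x) w)
    {u f : Lp ℂ 2 (volume : Measure (Space n))} (hu : ∀ᵐ x, x ∈ Ω → u x = v x - w x)
    (huf : ∀ ψ : 𝓓(Ω, ℂ), inner ℂ (toL2 (diffOp P ψ)) u = inner ℂ (toL2 ψ) f) :
    ∀ᵐ x, x ∈ Ω → f x - lam * u x = -(lam * (V x * w x)) := by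
  have hloc : ∀ g : Lp ℂ 2 (volume : Measure (Space n)), MemL2Loc Ω g :=
    fun g K _ _ => (Lp.memLp g).restrict K
  have hone : MemLp (fun _ : Space n => (1 : ℝ)) ∞ volume := memLp_top_const 1
  have hL : ∀ {g : Space n → ℂ}, MemL2Loc Ω g → LocallyIntegrableOn g Ω volume := by
    intro g hg
    simpa using hg.locallyIntegrableOn hone
  have hG : LocallyIntegrableOn (fun x => f x - lam * u x + lam * (V x * w x)) Ω volume :=
    ((hL (hloc f)).sub ((hL (hloc u)).smul lam)).add ((hw.locallyIntegrableOn hV).smul lam)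
  have hzero := ae_eq_zero_of_integral_mul_test hG ?_
  · filter_upwards [hzero] with x hx hxΩ
    linear_combination hx hxΩ
  intro φ
  have e1 := hvs φ
  have e2 := hws φ
  -- Testing with the conjugate turns the `L²` identity into `∫ u P(-D)φ = ∫ f φ`, comparable with
  -- the two weak equations at `φ`.
  have e3 := huf (conjTest φ)
  rw [inner_toL2_eq_setIntegral _ hu,
    inner_toL2_eq_setIntegral _ (Eventually.of_forall fun _ _ => rfl)] at e3
  simp only [conj_diffOp, conjTest_conjTest, conjTest_apply, starRingEnd_self_apply] at e3
  have ivt := hv.integrable_mul_test (diffOpTranspose P φ)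
  have iwt := hw.integrable_mul_test (diffOpTranspose P φ)
  have iv := hv.integrable_mul_test φ
  have iw := hw.integrable_mul_test φ
  have iwV := hw.integrable_mul hV φ
  have ifφ := (hloc f).integrable_mul_test φ
  have hu' : ∫ x in (Ω : Set (Space n)), u x * φ x
      = ∫ x in (Ω : Set (Space n)), (v x * φ x - w x * φ x) := by
    refine setIntegral_congr_ae Ω.isOpen.measurableSet ?_
    filter_upwards [hu] with x hx hxΩ
    rw [hx hxΩ, sub_mul]
  have s1 : ∫ x in (Ω : Set (Space n)), v x * (diffOpTranspose P φ x - lam * ((1 : ℝ) : ℂ) * φ x)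
      = (∫ x in (Ω : Set (Space n)), v x * diffOpTranspose P φ x)
        - lam * ∫ x in (Ω : Set (Space n)), v x * φ x := by
    rw [← integral_const_mul, ← integral_sub ivt (iv.const_mul lam)]
    congr 1
    ext x
    push_cast
    ring
  have s2 : ∫ x in (Ω : Set (Space n)),
        w x * (diffOpTranspose P φ x - lam * ((1 + V x : ℝ) : ℂ) * φ x)
      = (∫ x in (Ω : Set (Space n)), w x * diffOpTranspose P φ x)
        - lam * (∫ x in (Ω : Set (Space n)), w x * φ x)
        - lam * ∫ x in (Ω : Set (Space n)), w x * (V x * φ x) := by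
    have i1 : IntegrableOn (fun x => w x * diffOpTranspose P φ x - lam * (w x * φ x)) Ω volume :=
      iwt.sub (iw.const_mul lam)
    rw [← integral_const_mul, ← integral_const_mul, ← integral_sub iwt (iw.const_mul lam),
      ← integral_sub i1 (iwV.const_mul lam)]
    congr 1
    ext x
    push_cast
    ring
  have s3 : ∫ x in (Ω : Set (Space n)), (v x - w x) * diffOpTranspose P φ x
      = (∫ x in (Ω : Set (Space n)), v x * diffOpTranspose P φ x)
        - ∫ x in (Ω : Set (Space n)), w x * diffOpTranspose P φ x := by
    rw [← integral_sub ivt iwt]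
    congr 1
    ext x
    ring
  have s4 : ∫ x in (Ω : Set (Space n)), (f x - lam * u x + lam * (V x * w x)) * φ x
      = (∫ x in (Ω : Set (Space n)), f x * φ x)
        - lam * (∫ x in (Ω : Set (Space n)), u x * φ x)
        + lam * ∫ x in (Ω : Set (Space n)), w x * (V x * φ x) := by
    have iu := (hloc u).integrable_mul_test φ
    have i1 : IntegrableOn (fun x => f x * φ x - lam * (u x * φ x)) Ω volume :=
      ifφ.sub (iu.const_mul lam)
    rw [← integral_const_mul, ← integral_const_mul, ← integral_sub ifφ (iu.const_mul lam),
      ← integral_add i1 (iwV.const_mul lam)]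
    congr 1
    ext x
    ring
  rw [integral_sub iv iw] at hu'
  rw [s1] at e1
  rw [s2] at e2
  rw [s3] at e3
  rw [s4, hu']
  linear_combination e1 - e2 - e3

/-! ### The weights `V^{±1/2}` -/

section Weight

variable {V : Space n → ℝ} {δ : ℝ}

/-- The weight `V^{-1/2}` on `Ω`. -/
def invSqrtWeight (Ω : Opens (Space n)) (V : Space n → ℝ) : Space n → ℝ :=
  (Ω : Set (Space n)).indicator fun x => (Real.sqrt (V x))⁻¹

/-- The weight `V^{1/2}` on `Ω`. -/
def sqrtWeight (Ω : Opens (Space n)) (V : Space n → ℝ) : Space n → ℝ :=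
  (Ω : Set (Space n)).indicator fun x => Real.sqrt (V x)

theorem memLp_invSqrtWeight (hV : MemLp V ∞ volume) (hδ : 0 < δ)
    (hVδ : ∀ᵐ x, x ∈ Ω → δ ≤ V x) : MemLp (invSqrtWeight Ω V) ∞ volume := by
  have hm : AEStronglyMeasurable (invSqrtWeight Ω V) volume :=
    ((Real.continuous_sqrt.comp_aestronglyMeasurable hV.1).aemeasurable.inv.aestronglyMeasurable
      ).indicator Ω.isOpen.measurableSet
  refine memLp_top_of_bound hm (Real.sqrt δ)⁻¹ ?_
  filter_upwards [hVδ] with x hx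
  by_cases hxΩ : x ∈ (Ω : Set (Space n))
  · rw [invSqrtWeight, Set.indicator_of_mem hxΩ, Real.norm_of_nonneg (by positivity)]
    exact inv_anti₀ (Real.sqrt_pos.2 hδ) (Real.sqrt_le_sqrt (hx hxΩ))
  · rw [invSqrtWeight, Set.indicator_of_notMem hxΩ, norm_zero]
    positivity

theorem memLp_sqrtWeight (hV : MemLp V ∞ volume) : MemLp (sqrtWeight Ω V) ∞ volume := by
  have hm : AEStronglyMeasurable (sqrtWeight Ω V) volume :=
    (Real.continuous_sqrt.comp_aestronglyMeasurable hV.1).indicator Ω.isOpen.measurableSet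
  obtain ⟨C, hC⟩ : ∃ C, ∀ᵐ x, ‖V x‖ ≤ C := by
    obtain ⟨C, hC⟩ := eLpNormEssSup_lt_top_iff_isBoundedUnder.1
      (by simpa [eLpNorm_exponent_top] using hV.2)
    exact ⟨C, hC.mono fun x hx => NNReal.coe_le_coe.2 hx⟩
  refine memLp_top_of_bound hm (Real.sqrt C) ?_
  filter_upwards [hC] with x hx
  by_cases hxΩ : x ∈ (Ω : Set (Space n))
  · rw [sqrtWeight, Set.indicator_of_mem hxΩ, Real.norm_of_nonneg (by positivity)]
    exact Real.sqrt_le_sqrt ((le_abs_self _).trans hx)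
  · rw [sqrtWeight, Set.indicator_of_notMem hxΩ, norm_zero]
    positivity

theorem sqrtWeight_mul_invSqrtWeight (hδ : 0 < δ) {x : Space n} (hx : x ∈ Ω) (hVx : δ ≤ V x) :
    sqrtWeight Ω V x * invSqrtWeight Ω V x = 1 := by
  have hx' : x ∈ (Ω : Set (Space n)) := hx
  rw [sqrtWeight, invSqrtWeight, Set.indicator_of_mem hx', Set.indicator_of_mem hx']
  exact mul_inv_cancel₀ (Real.sqrt_pos.2 (hδ.trans_le hVx)).ne'

theorem invSqrtWeight_sq_mul (hδ : 0 < δ) {x : Space n} (hx : x ∈ Ω) (hVx : δ ≤ V x) :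
    invSqrtWeight Ω V x ^ 2 * V x = 1 := by
  have hx' : x ∈ (Ω : Set (Space n)) := hx
  have hpos := hδ.trans_le hVx
  rw [invSqrtWeight, Set.indicator_of_mem hx', inv_pow, Real.sq_sqrt hpos.le]
  exact inv_mul_cancel₀ hpos.ne'

/-- The weights are inverse to each other only on `Ω`, which suffices because test functions vanish
elsewhere. Weighted and unweighted norms are thus equivalent on test functions. -/
theorem mulOp_sqrtWeight_mulOp_invSqrtWeight (hδ : 0 < δ) (hVδ : ∀ᵐ x, x ∈ Ω → δ ≤ V x)
    (ha : MemLp (invSqrtWeight Ω V) ∞ volume) (hb : MemLp (sqrtWeight Ω V) ∞ volume)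
    (φ : 𝓓(Ω, ℂ)) : mulOp hb (mulOp ha (toL2 φ)) = toL2 φ := by
  apply Lp.ext
  filter_upwards [coeFn_mulOp hb (mulOp ha (toL2 φ)), coeFn_mulOp ha (toL2 φ), coeFn_toL2 φ, hVδ]
    with x h1 h2 h3 h4
  rw [h1, h2, h3, ← mul_assoc, ← Complex.ofReal_mul]
  by_cases hx : x ∈ Ω
  · rw [sqrtWeight_mul_invSqrtWeight hδ hx (h4 hx), Complex.ofReal_one, one_mul]
  · rw [apply_eq_zero_of_notMem φ hx, mul_zero]

end Weight

/-! ### The variational form of the transmission problem -/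

/-- The fourth-order equation `(P - λ(1 + V)) V⁻¹ (P - λ) u = 0` in variational form. -/
theorem inner_variational_eq_zero {P : MvPolynomial (Fin n) ℝ} {V : Space n → ℝ} {δ : ℝ}
    (hδ : 0 < δ) (hVδ : ∀ᵐ x, x ∈ Ω → δ ≤ V x)
    (ha : MemLp (invSqrtWeight Ω V) ∞ volume) (hV1 : MemLp (fun x => 1 + V x) ∞ volume)
    {lam : ℂ} {w : Space n → ℂ} (hws : WeakSolution P Ω lam (fun x => 1 + V x) w)
    {u f : Lp ℂ 2 (volume : Measure (Space n))}
    (hfu : ∀ᵐ x, x ∈ Ω → f x - lam * u x = -(lam * (V x * w x))) (ψ : 𝓓(Ω, ℂ)) :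
    inner ℂ (mulOp ha (toL2 (diffOp P ψ))
      - (starRingEnd ℂ) lam • mulOp hV1 (mulOp ha (toL2 ψ)))
      (mulOp ha f - lam • mulOp ha u) = 0 := by
  -- On `Ω` one has `f - λu = -λVw`, and the two factors `V^{-1/2}` cancel this `V`. The inner
  -- product is then `-λ` times the weak equation for `w` tested with the conjugate of `ψ`.
  have e := hws (conjTest ψ)
  rw [L2.inner_def]
  have key : ∫ x, inner ℂ ((mulOp ha (toL2 (diffOp P ψ))
        - (starRingEnd ℂ) lam • mulOp hV1 (mulOp ha (toL2 ψ)) : Lp ℂ 2 volume) x)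
        ((mulOp ha f - lam • mulOp ha u : Lp ℂ 2 volume) x)
      = ∫ x in (Ω : Set (Space n)), -lam * (w x * (diffOpTranspose P (conjTest ψ) x
          - lam * ((1 + V x : ℝ) : ℂ) * conjTest ψ x)) := by
    rw [← integral_indicator Ω.isOpen.measurableSet]
    refine integral_congr_ae ?_
    filter_upwards [Lp.coeFn_sub (mulOp ha (toL2 (diffOp P ψ)))
        ((starRingEnd ℂ) lam • mulOp hV1 (mulOp ha (toL2 ψ))),
      Lp.coeFn_smul ((starRingEnd ℂ) lam) (mulOp hV1 (mulOp ha (toL2 ψ))),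
      Lp.coeFn_sub (mulOp ha f) (lam • mulOp ha u), Lp.coeFn_smul lam (mulOp ha u),
      coeFn_mulOp ha (toL2 (diffOp P ψ)), coeFn_mulOp hV1 (mulOp ha (toL2 ψ)),
      coeFn_mulOp ha (toL2 ψ), coeFn_mulOp ha f, coeFn_mulOp ha u, coeFn_toL2 (diffOp P ψ),
      coeFn_toL2 ψ, hfu, hVδ] with x h1 h2 h3 h4 h5 h6 h7 h8 h9 h10 h11 h12 h13
    rw [h1, h3, Pi.sub_apply, Pi.sub_apply, h2, h4, Pi.smul_apply, Pi.smul_apply, h5, h6, h7, h8,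
      h9, h10, h11, RCLike.inner_apply]
    by_cases hx : x ∈ (Ω : Set (Space n))
    · rw [Set.indicator_of_mem hx, ← conj_diffOp, conjTest_apply]
      have h14 := invSqrtWeight_sq_mul hδ hx (h13 hx)
      have h15 : ((invSqrtWeight Ω V x : ℝ) : ℂ) ^ 2 * ((V x : ℝ) : ℂ) = 1 := by
        exact_mod_cast h14
      have h16 := h12 hx
      simp only [smul_eq_mul, map_sub, map_mul, Complex.conj_ofReal, starRingEnd_self_apply]
      generalize (invSqrtWeight Ω V x : ℂ) = a at *
      have h17 : a * f x - lam * (a * u x) = -(a * (lam * (V x * w x))) := by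
        linear_combination a * h16
      rw [h17]
      linear_combination (-lam * w x * ((starRingEnd ℂ) (diffOp P ψ x)
        - lam * ((1 + V x : ℝ) : ℂ) * (starRingEnd ℂ) (ψ x))) * h15
    · rw [Set.indicator_of_notMem hx, apply_eq_zero_of_notMem ψ hx,
        apply_eq_zero_of_notMem (diffOp P ψ) hx]
      simp
  rw [key, integral_const_mul, e, mul_zero]

/-- The embedding of test functions into `L²`, with a weight. -/
def weightedEmbedding (Ω : Opens (Space n)) {a : Space n → ℝ} (ha : MemLp a ∞ volume) :
    𝓓(Ω, ℂ) →ₗ[ℂ] Lp ℂ 2 (volume : Measure (Space n)) :=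
  (mulOp ha).toLinearMap ∘ₗ toL2

theorem weightedEmbedding_apply {a : Space n → ℝ} (ha : MemLp a ∞ volume) (φ : 𝓓(Ω, ℂ)) :
    weightedEmbedding Ω ha φ = mulOp ha (toL2 φ) := rfl

/-- The weighted embedding of a transmission eigenfunction solves the variational problem. -/
theorem IsTransmissionEigenvalue.exists_variational {P : MvPolynomial (Fin n) ℝ} (hP0 : P ≠ 0)
    (hΩb : Bornology.IsBounded (Ω : Set (Space n)))
    {V : Space n → ℝ} (hV : MemLp V ∞ volume) {δ : ℝ} (hδ : 0 < δ)
    (hVδ : ∀ᵐ x, x ∈ Ω → δ ≤ V x) (ha : MemLp (invSqrtWeight Ω V) ∞ volume)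
    (hV1 : MemLp (fun x => 1 + V x) ∞ volume) {lam : ℂ} (hlam : lam ≠ 0)
    (h : IsTransmissionEigenvalue P Ω V lam) :
    ∃ (φ : ℕ → 𝓓(Ω, ℂ)) (F U : Lp ℂ 2 (volume : Measure (Space n))), F ≠ 0 ∧
      Tendsto (fun k => mulOp ha (toL2 (diffOp P (φ k)))) atTop (𝓝 F) ∧
      Tendsto (fun k => mulOp ha (toL2 (φ k))) atTop (𝓝 U) ∧
      ∀ ψ : 𝓓(Ω, ℂ), inner ℂ (mulOp ha (toL2 (diffOp P ψ))
        - (starRingEnd ℂ) lam • mulOp hV1 (mulOp ha (toL2 ψ))) (F - lam • U) = 0 := by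
  obtain ⟨v, w, hv, hw, hv0, hw0, hvs, hws, hu, φ, hPφ, hφ⟩ := h
  obtain ⟨K, hK, hKbound⟩ := exists_norm_toL2_le hΩb hP0
  have hu' : MemLp ((Ω : Set (Space n)).indicator (v - w)) 2 volume :=
    (memLp_indicator_iff_restrict Ω.isOpen.measurableSet).2 hu
  have hφu := tendsto_toL2_indicator hu' hφ
  obtain ⟨f, hf⟩ := cauchySeq_tendsto_of_complete (cauchySeq_toL2_diffOp hPφ)
  have hae : ∀ᵐ x, x ∈ Ω → (hu'.toLp _ : Space n → ℂ) x = v x - w x := by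
    filter_upwards [hu'.coeFn_toLp] with x hx hxΩ
    rw [hx, Set.indicator_of_mem (show x ∈ (Ω : Set (Space n)) from hxΩ), Pi.sub_apply]
  generalize hu'.toLp _ = u at hφu hae
  have hfu := ae_eq_of_weakSolution hV hv hw hvs hws hae (inner_diffOp_of_tendsto hφu hf)
  have hpF : Tendsto (fun k => mulOp ha (toL2 (diffOp P (φ k)))) atTop (𝓝 (mulOp ha f)) :=
    ((mulOp ha).continuous.tendsto f).comp hf
  refine ⟨φ, mulOp ha f, mulOp ha u, fun hF => hw0 ?_, hpF,
    ((mulOp ha).continuous.tendsto u).comp hφu,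
    inner_variational_eq_zero hδ hVδ ha hV1 hws hfu⟩
  -- If `F = 0`, undoing the weight gives `f = 0`, then `u = 0`, and `λ V w = 0` forces `w = 0`.
  have hf0 : f = 0 := by
    have hb : MemLp (sqrtWeight Ω V) ∞ volume := memLp_sqrtWeight hV
    have h1 := ((mulOp hb).continuous.tendsto _).comp hpF
    rw [hF, map_zero] at h1
    refine tendsto_nhds_unique hf (h1.congr fun k => ?_)
    exact mulOp_sqrtWeight_mulOp_invSqrtWeight hδ hVδ ha hb (diffOp P (φ k))
  have hu0 : u = 0 := by
    refine tendsto_nhds_unique hφu (squeeze_zero_norm (fun k => hKbound (φ k)) ?_)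
    simpa [hf0] using hf.norm.const_mul K
  rw [Filter.EventuallyEq, ae_restrict_iff' Ω.isOpen.measurableSet]
  filter_upwards [hfu, hVδ, Lp.coeFn_zero ℂ 2 (volume : Measure (Space n))] with x h1 h2 h3 hxΩ
  have h4 := h1 hxΩ
  rw [hf0, hu0, h3] at h4
  have hV0 : (V x : ℂ) ≠ 0 := by
    exact_mod_cast (hδ.trans_le (h2 hxΩ)).ne'
  simpa [hlam, hV0] using h4

/-! ### Discreteness -/

/-- There are only finitely many transmission eigenvalues in each disc. -/
theorem finite_isTransmissionEigenvalue {P : MvPolynomial (Fin n) ℝ} (hP0 : P ≠ 0)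
    (hΩb : Bornology.IsBounded (Ω : Set (Space n)))
    {V : Space n → ℝ} (hV : MemLp V ∞ volume) {δ : ℝ} (hδ : 0 < δ)
    (hVδ : ∀ᵐ x, x ∈ Ω → δ ≤ V x)
    (hP : Tendsto (symbolTilde P) (Bornology.cobounded (Space n)) atTop) (r : ℝ) :
    {lam : ℂ | ‖lam‖ ≤ r ∧ IsTransmissionEigenvalue P Ω V lam}.Finite := by
  have ha := memLp_invSqrtWeight hV hδ hVδ
  have hb : MemLp (sqrtWeight Ω V) ∞ volume := memLp_sqrtWeight hV
  have hV1 : MemLp (fun x => 1 + V x) ∞ volume := (memLp_top_const (1 : ℝ)).add hV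
  have hba := mulOp_sqrtWeight_mulOp_invSqrtWeight hδ hVδ ha hb
  obtain ⟨K, hK, hKbound⟩ := exists_norm_toL2_le hΩb hP0
  have hp : ∀ φ : 𝓓(Ω, ℂ),
      ‖toL2 (diffOp P φ)‖ ≤ ‖mulOp hb‖ * ‖mulOp ha (toL2 (diffOp P φ))‖ := by
    intro φ
    have := (mulOp hb).le_opNorm (mulOp ha (toL2 (diffOp P φ)))
    rwa [hba (diffOp P φ)] at this
  have hfin := finite_variational_pencil (weightedEmbedding Ω ha ∘ₗ diffOpLin P)
    (weightedEmbedding Ω ha) (mulOp hV1) ?_ ?_ r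
  · refine (hfin.union (Set.finite_singleton 0)).subset ?_
    rintro lam ⟨hr, h⟩
    -- At `λ = 0` the relation `(P - λ) u = -λ V w` no longer determines `w`; this single point is
    -- added by hand.
    by_cases hlam : lam = 0
    · exact Or.inr hlam
    · exact Or.inl ⟨hr, h.exists_variational hP0 hΩb hV hδ hVδ ha hV1 hlam⟩
  · refine ⟨‖mulOp ha‖ * (K * ‖mulOp hb‖), fun φ => ?_⟩
    rw [LinearMap.comp_apply, weightedEmbedding_apply, weightedEmbedding_apply, diffOpLin_apply]
    refine ((mulOp ha).le_opNorm _).trans ?_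
    rw [mul_assoc, mul_assoc]
    exact mul_le_mul_of_nonneg_left
      ((hKbound φ).trans (mul_le_mul_of_nonneg_left (hp φ) hK)) (norm_nonneg _)
  · rintro φ ⟨M, hM⟩ hw
    simp only [LinearMap.comp_apply, weightedEmbedding_apply, diffOpLin_apply] at hM hw ⊢
    have h1 : WeaklyNull fun k => toL2 (φ k) := by
      have := hw.map (mulOp hb)
      simpa only [hba] using this
    have h2 := tendsto_toL2_zero hΩb hP (M := ‖mulOp hb‖ * M)
      (fun k => (hp (φ k)).trans (mul_le_mul_of_nonneg_left (hM k) (norm_nonneg _))) h1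
    simpa [Function.comp_def] using ((mulOp ha).continuous.tendsto 0).comp h2

theorem isClosed_and_isDiscrete_of_finite {S : Set ℂ} (h : ∀ r : ℝ, {z | ‖z‖ ≤ r ∧ z ∈ S}.Finite) :
    IsClosed S ∧ IsDiscrete S := by
  rw [isClosed_and_discrete_iff]
  intro z
  -- The disc of radius `‖z‖ + 1` contains the unit ball about `z`, so removing finitely many points
  -- leaves a punctured neighbourhood of `z` free of `S`.
  have hfin := h (‖z‖ + 1)
  rw [Filter.disjoint_principal_right]
  have h1 : ({z' | ‖z'‖ ≤ ‖z‖ + 1 ∧ z' ∈ S} \ {z})ᶜ ∈ 𝓝 z :=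
    (hfin.subset Set.sdiff_subset).isClosed.isOpen_compl.mem_nhds (by simp)
  have h2 : Metric.ball z 1 ∈ 𝓝 z := Metric.ball_mem_nhds z one_pos
  filter_upwards [mem_nhdsWithin_of_mem_nhds h1, mem_nhdsWithin_of_mem_nhds h2,
    self_mem_nhdsWithin] with y hy1 hy2 hy3 hyS
  refine hy1 ⟨⟨?_, hyS⟩, hy3⟩
  have h3 : ‖y‖ ≤ ‖z‖ + ‖y - z‖ := by
    simpa using norm_add_le z (y - z)
  rw [Metric.mem_ball, dist_eq_norm] at hy2
  linarith

end Acoustic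

end

theorem theorem6p1 (n : ℕ) (P₀ : MvPolynomial (Fin n) ℝ) (hdeg : 2 ≤ P₀.totalDegree)
    (Ω : Opens (Acoustic.Space n)) (hΩ : IsConnected (Ω : Set (Acoustic.Space n)))
    (hΩb : Bornology.IsBounded (Ω : Set (Acoustic.Space n)))
    (V : Acoustic.Space n → ℝ) (hV : MemLp V ∞ volume)
    (hVsupp : Acoustic.essSupport V = closure (Ω : Set (Acoustic.Space n)))
    (δ : ℝ) (hδ : 0 < δ)
    (hVδ : ∀ᵐ x ∂(volume.restrict (closure (Ω : Set (Acoustic.Space n)))), δ ≤ V x)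
    (hP : Tendsto (Acoustic.symbolTilde P₀) (Bornology.cobounded (Acoustic.Space n)) atTop) :
    IsClosed {lam : ℂ | Acoustic.IsTransmissionEigenvalue P₀ Ω V lam} ∧
    IsDiscrete {lam : ℂ | Acoustic.IsTransmissionEigenvalue P₀ Ω V lam} := by
  have hP0 : P₀ ≠ 0 := by
    rintro rfl
    simp at hdeg
  have hVδ' : ∀ᵐ x, x ∈ Ω → δ ≤ V x := by
    rw [ae_restrict_iff' isClosed_closure.measurableSet] at hVδ
    filter_upwards [hVδ] with x hx hxΩ
    exact hx (subset_closure hxΩ)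
  exact Acoustic.isClosed_and_isDiscrete_of_finite
    (Acoustic.finite_isTransmissionEigenvalue hP0 hΩb hV hδ hVδ' hP)
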